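/- **Setting.** Fix $n\ge 0$. An *ice quiver* $Q$ on the vertices $1,\dots,n$ (no loops or directed 2-cycles) is recorded by the skew-symmetric integer matrix $Q_{ij}=\#(\text{arrows } i\to j)-\#(\text{arrows } j\to i)$ together with a subset of *frozen* vertices; the other vertices are *mutable*. $Q$ is *acyclic* if the induced subquiver on the mutable vertices has no directed cycle. A *seed* $(Q,\mathbf a)$ is an ice quiver with a tuple $\mathbf a=(a_1,\dots,a_n)$ in $\mathbb Q(x_1,\dots,x_n)$; it is acyclic if $Q$ is. *Mutation* at a mutable vertex $k$ keeps the frozen vertices, replaces $Q_{ij}$ by $-Q_{ij}$ if $k\in\{i,j\}$ and by $Q_{ij}+\frac{|Q_{ik}|Q_{kj}+Q_{ik}|Q_{kj}|}{2}$ otherwise, and replaces $a_k$ by $a_k^{-1}\big(\prod_{Q_{kj}>0}a_j^{Q_{kj}}+\prod_{Q_{kj}<0}a_j^{-Q_{kj}}\big)$, leaving the other $a_i$ unchanged. Seeds are *mutation equivalent* if they are related by a finite sequence of mutations. The *cluster algebra* $\mathcal A(Q,\mathbf a)$ is the subring of $\mathbb Q(x_1,\dots,x_n)$ generated by all entries of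 all seeds mutation equivalent to $(Q,\mathbf a)$ and the inverses of the frozen variables. It is *acyclic* if some seed mutation equivalent to $(Q,\mathbf a)$ is acyclic. *Freezing* a set $S$ of mutable vertices of a seed keeps $\mathbf a$ and the arrows and declares the vertices in $S$ frozen. If $t$ is obtained from a seed of $\mathcal A$, with cluster $\mathbf a$, by freezing $S$, then $\mathcal A(t)$ is a *cluster localization* of $\mathcal A$ if $\mathcal A(t)=\mathcal A[a_i^{-1}: i\in S]$; the induced open immersion $\operatorname{Spec}\mathcal A(t)\to\operatorname{Spec}\mathcal A$ is then called a *cluster chart*, and it is an acyclic cluster chart if $\mathcal A(t)$ is acyclic. $\mathcal A$ is *locally acyclic* if $\operatorname{Spec}\mathcal A$ has a finite cover by acyclic cluster charts. A *covering pair* in $Q$ is a pair $(i_1,i_2)$ of mutable vertices with an arrow $i_1\to i_2$ such that there is no sequence $(p_k)_{k\in\mathbb Z}$ of mutable vertices with $Q_{p_k p_{k+1}}>0$ for all $k$ and $p_1=i_1$, $p_2=i_2$. The (non-deterministic) *Banff algorithm* takes a seed $s$ as input. (1) If $s$ is mutation equivalent to an acyclic seed, stop and output one such acyclic seed. (2)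 Otherwise choose a seed $s'$ mutation equivalent to $s$ and a covering pair $(i_1,i_2)$ in the quiver of $s'$; if there is none, fail. (3) Run the algorithm on each of the two seeds obtained from $s'$ by freezing $i_1$, respectively $i_2$; the output is the union of the two outputs, and the algorithm fails if one of the two runs fails. **Theorem.** Let $s=(Q,\mathbf a)$ be a seed whose cluster $a_1,\dots,a_n$ is algebraically independent over $\mathbb Q$, and let $\mathcal A=\mathcal A(s)$. If some run of the Banff algorithm on $s$ does not fail and outputs the set $O$ of seeds, then $O$ is a finite set of acyclic seeds, $\mathcal A(t)$ is a cluster localization of $\mathcal A$ for each $t\in O$, and the acyclic cluster charts $\operatorname{Spec}\mathcal A(t)\to\operatorname{Spec}\mathcal A$, $t\in O$, cover $\operatorname{Spec}\mathcal A$. Hence $\mathcal A$ is locally acyclic. -/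

import Mathlib

noncomputable section

namespace ClusterAlg

open AlgebraicGeometry

/-- An ice quiver on the vertices `0, …, n - 1`, without loops or directed 2-cycles, recorded by its
skew-symmetric integer matrix: `arrows i j` is the number of arrows from `i` to `j` minus the number
of arrows from `j` to `i` (so there are `max (arrows i j) 0` arrows from `i` to `j`), together with
the set of frozen vertices. -/
@[ext] structure IceQuiver (n : ℕ) where
  arrows : Matrix (Fin n) (Fin n) ℤ
  skew : ∀ i j, arrows j i = -arrows i j
  frozen : Finset (Fin n)

namespace IceQuiver

variable {n : ℕ}

/-- A vertex is mutable if it is not frozen. -/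
def IsMutable (Q : IceQuiver n) (i : Fin n) : Prop := i ∉ Q.frozen

/-- There is at least one arrow from `i` to `j` in the induced subquiver on the mutable vertices. -/
def MutArrow (Q : IceQuiver n) (i j : Fin n) : Prop :=
  Q.IsMutable i ∧ Q.IsMutable j ∧ 0 < Q.arrows i j

/-- `Q` is acyclic: its mutable subquiver has no directed cycle. -/
def IsAcyclic (Q : IceQuiver n) : Prop := ∀ i, ¬ Relation.TransGen Q.MutArrow i i

/-- A bi-infinite path of mutable vertices. -/
def IsBiinfinitePath (Q : IceQuiver n) (p : ℤ → Fin n) : Prop :=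
  ∀ k, Q.MutArrow (p k) (p (k + 1))

/-- `(i, j)` is a covering pair: two mutable vertices with an arrow from `i` to `j` which is not in
any bi-infinite path of mutable vertices. -/
def IsCoveringPair (Q : IceQuiver n) (i j : Fin n) : Prop :=
  Q.MutArrow i j ∧ ¬ ∃ p : ℤ → Fin n, Q.IsBiinfinitePath p ∧ p 1 = i ∧ p 2 = j

/-- Matrix mutation at `k`. The integer division by `2` is exact. -/
def mutateArrows (B : Matrix (Fin n) (Fin n) ℤ) (k : Fin n) : Matrix (Fin n) (Fin n) ℤ :=
  fun i j => if k = i ∨ k = j then -B i j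
    else B i j + (|B i k| * B k j + B i k * |B k j|) / 2

theorem mutateArrows_skew (B : Matrix (Fin n) (Fin n) ℤ) (hB : ∀ i j, B j i = -B i j)
    (k i j : Fin n) : mutateArrows B k j i = -mutateArrows B k i j := by
  have even_aux : ∀ x y : ℤ, (2 : ℤ) ∣ |x| * y + x * |y| := by
    intro x y
    rcases abs_choice x with hx | hx <;> rcases abs_choice y with hy | hy <;> rw [hx, hy]
    · exact ⟨x * y, by ring⟩
    · exact ⟨0, by ring⟩
    · exact ⟨0, by ring⟩
    · exact ⟨-(x * y), by ring⟩
  unfold mutateArrows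
  by_cases h : k = i ∨ k = j
  · rw [if_pos h, if_pos h.symm, hB i j]
  · rw [if_neg h, if_neg (fun h' => h h'.symm), hB i j, hB k j, hB i k, abs_neg, abs_neg]
    have e : |B k j| * -B i k + -B k j * |B i k| = -(|B i k| * B k j + B i k * |B k j|) := by ring
    rw [e, Int.neg_ediv_of_dvd (even_aux _ _)]
    ring

/-- Mutation of an ice quiver at `k`; the frozen vertices stay the same. -/
def mutate (Q : IceQuiver n) (k : Fin n) : IceQuiver n where
  arrows := mutateArrows Q.arrows k
  skew := mutateArrows_skew Q.arrows Q.skew k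
  frozen := Q.frozen

/-- Freeze the vertices in `S`. -/
def freeze (Q : IceQuiver n) (S : Finset (Fin n)) : IceQuiver n where
  arrows := Q.arrows
  skew := Q.skew
  frozen := Q.frozen ∪ S

end IceQuiver

/-- The field `ℚ(x₁, …, xₙ)`. -/
abbrev RatFunField (n : ℕ) : Type := FractionRing (MvPolynomial (Fin n) ℚ)

/-- A seed of rank `n`: an ice quiver on `n` vertices and a map from the vertices to
`ℚ(x₁, …, xₙ)`. -/
@[ext] structure Seed (n : ℕ) where
  quiver : IceQuiver n
  cluster : Fin n → RatFunField n

namespace Seed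

variable {n : ℕ}

/-- Mutation of a seed at `k`. Since `Int.toNat` is `0` on negative integers, the two products are
over the arrows out of `k` and into `k`, respectively. -/
def mutate (s : Seed n) (k : Fin n) : Seed n where
  quiver := s.quiver.mutate k
  cluster := Function.update s.cluster k
    ((∏ j, s.cluster j ^ (s.quiver.arrows k j).toNat
      + ∏ j, s.cluster j ^ (-s.quiver.arrows k j).toNat) * (s.cluster k)⁻¹)

/-- `t` is obtained from `s` by a finite (possibly empty) sequence of mutations at mutable
vertices. -/
def MutEquiv (s t : Seed n) : Prop :=
  Relation.ReflTransGen
    (fun u v : Seed n => ∃ k, u.quiver.IsMutable k ∧ v = u.mutate k) s t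

/-- The seed `s` with the vertices in `S` frozen. -/
def freeze (s : Seed n) (S : Finset (Fin n)) : Seed n where
  quiver := s.quiver.freeze S
  cluster := s.cluster

/-- A seed is acyclic if its ice quiver is. -/
def IsAcyclic (s : Seed n) : Prop := s.quiver.IsAcyclic

/-- The functions that occur in some seed mutation equivalent to `s` (frozen ones included). -/
def clusterVariables (s : Seed n) : Set (RatFunField n) :=
  {x | ∃ t, s.MutEquiv t ∧ ∃ i, x = t.cluster i}

/-- The inverses of the variables of `s` at the vertices in `S`. -/
def invVariables (s : Seed n) (S : Finset (Fin n)) : Set (RatFunField n) :=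
  {x | ∃ i ∈ S, x = (s.cluster i)⁻¹}

/-- The cluster algebra `𝒜(s)`: the subring of `ℚ(x₁, …, xₙ)` generated by the cluster variables
and the inverses of the frozen variables. -/
def clusterAlgebra (s : Seed n) : Subalgebra ℤ (RatFunField n) :=
  Algebra.adjoin ℤ (s.clusterVariables ∪ s.invVariables s.quiver.frozen)

/-- The cluster algebra of `s` is acyclic: it has an acyclic seed. -/
def HasAcyclicSeed (s : Seed n) : Prop := ∃ t, s.MutEquiv t ∧ t.IsAcyclic

/-- `t` is a freezing of a seed of `𝒜(s)` and `𝒜(t)` is a cluster localization of `𝒜(s)`: for some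
seed `u` of `𝒜(s)` and some set `S` of mutable vertices of `u`, the seed `t` is `u` with `S` frozen,
and `𝒜(t) = 𝒜(s)[aᵢ⁻¹ : i ∈ S]` inside `ℚ(x₁, …, xₙ)`. -/
def IsClusterLocalization (s t : Seed n) : Prop :=
  ∃ (u : Seed n) (S : Finset (Fin n)), s.MutEquiv u ∧ (∀ i ∈ S, u.quiver.IsMutable i) ∧
    t = u.freeze S ∧
    t.clusterAlgebra =
      Algebra.adjoin ℤ ((s.clusterAlgebra : Set (RatFunField n)) ∪ u.invVariables S)

/-- The affine scheme `Spec 𝒜(s)`. -/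
def clusterScheme (s : Seed n) : Scheme := Spec (CommRingCat.of s.clusterAlgebra)

/-- The morphism `Spec 𝒜(t) ⟶ Spec 𝒜(s)` dual to an inclusion `𝒜(s) ⊆ 𝒜(t)`. -/
def chartMap (s t : Seed n) (h : s.clusterAlgebra ≤ t.clusterAlgebra) :
    t.clusterScheme ⟶ s.clusterScheme :=
  Spec.map (CommRingCat.ofHom (Subalgebra.inclusion h).toRingHom)

/-- The finite set `T` of seeds defines a cover of `Spec 𝒜(s)` by acyclic cluster charts: for
each `t ∈ T` the cluster algebra `𝒜(t)` is acyclic and is a cluster localization of `𝒜(s)`, the dual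
morphism `Spec 𝒜(t) ⟶ Spec 𝒜(s)` is an open immersion, and the images of these morphisms together
are all of `Spec 𝒜(s)`. -/
structure IsFiniteAcyclicCover (s : Seed n) (T : Set (Seed n)) : Prop where
  finite : T.Finite
  acyclic : ∀ t ∈ T, t.HasAcyclicSeed
  localization : ∀ t ∈ T, s.IsClusterLocalization t
  openImmersion : ∀ t ∈ T, ∃ h : s.clusterAlgebra ≤ t.clusterAlgebra,
    IsOpenImmersion (chartMap s t h)
  covers : ∀ P : s.clusterScheme, ∃ t ∈ T, ∃ h : s.clusterAlgebra ≤ t.clusterAlgebra,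
    P ∈ Set.range (chartMap s t h)

/-- The cluster algebra `𝒜(s)` is locally acyclic. -/
def LocallyAcyclic (s : Seed n) : Prop := ∃ T : Set (Seed n), s.IsFiniteAcyclicCover T

/-- `BanffOutput s O`: some run of the (non-deterministic) Banff algorithm on the input `s` does not
fail, and outputs the set `O` of seeds. -/
inductive BanffOutput : Seed n → Set (Seed n) → Prop
  | halt (s t : Seed n) : s.MutEquiv t → t.IsAcyclic → BanffOutput s {t}
  | branch (s s' : Seed n) (i₁ i₂ : Fin n) (O₁ O₂ : Set (Seed n)) :
      ¬ s.HasAcyclicSeed → s.MutEquiv s' → s'.quiver.IsCoveringPair i₁ i₂ →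
      BanffOutput (s'.freeze {i₁}) O₁ → BanffOutput (s'.freeze {i₂}) O₂ →
      BanffOutput s (O₁ ∪ O₂)

end Seed

end ClusterAlg

end

/-! Why the cover exists: let `χ` be a homomorphism from the cluster algebra to a field that kills
the variable at `v`. The exchange relation at `v` says that two monomials have images summing to
`0`, so some out-neighbour of `v` vanishes under `χ` iff some in-neighbour does. If both ends of an
arrow vanish, the arrow therefore extends both ways to a bi-infinite path of vanishing vertices, and
these are mutable because frozen variables are units. Hence the variables of a covering pair have no
common zero (`not_both_zero_of_isCoveringPair`). A point of the spectrum is followed down the run of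
the algorithm through its residue field: at each branching one of the two variables is nonzero, and
the homomorphism extends to that frozen cluster algebra (`exists_chartContains`).

Why the outputs are localizations: an intermediate freezing need not be one, since in general only
𝒜(freeze) ⊆ 𝒜[a⁻¹] holds. The other inclusion is needed at the acyclic outputs only. It comes from
the upper cluster algebra 𝒰, the intersection of the Laurent rings of all seeds: 𝒜 ⊆ 𝒰 ⊆ 𝒰(freeze) =
𝒜(freeze).

The first inclusion is the Laurent phenomenon (`isLaurent`), by induction on the length of the
mutation word. After extra vertices are adjoined to make exchange polynomials coprime, a new
variable has two denominators, one a power of a prime `p`, the other prime to `p`.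

The equality 𝒰 = 𝒜 for acyclic seeds (`IsAcyclic.upperAlgebra_le`) goes by induction on the number
of mutable vertices. Every mutable arrow of an acyclic quiver is a covering pair, so its two
variables generate the unit ideal and a Bézout identity glues the two freezings. The base case, with
no mutable arrows, is a computation with Laurent polynomials in one variable at a time
(`IsIsolated.upperAlgebra_le`). -/

noncomputable section

namespace ClusterAlg

open AddMonoidAlgebra AlgebraicGeometry

/-! ### Laurent polynomial rings: primality of binomials, evaluation -/

/-- The ring of Laurent polynomials with integer coefficients in variables indexed by `I`. -/
abbrev Laur (I : Type) : Type := AddMonoidAlgebra ℤ (I → ℤ)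

namespace Laur

variable {I : Type}

/-- The Laurent monomial with exponent vector `v`. -/
def mon (v : I → ℤ) : Laur I := single v 1

theorem mon_add (v w : I → ℤ) : mon (v + w) = mon v * mon w := by
  simp [mon, single_mul_single]

theorem mon_zero : mon (0 : I → ℤ) = 1 := rfl

theorem mon_pow (v : I → ℤ) (m : ℕ) : mon v ^ m = mon (m • v) := by
  induction m with
  | zero => simp [mon_zero]
  | succ m ih => rw [pow_succ, ih, succ_nsmul, mon_add]

theorem mon_mul_neg (v : I → ℤ) : mon v * mon (-v) = 1 := by
  rw [← mon_add, add_neg_cancel, mon_zero]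

theorem isUnit_mon (v : I → ℤ) : IsUnit (mon v) := IsUnit.of_mul_eq_one _ (mon_mul_neg v)

/-- The hom out of the Laurent polynomial ring given by a character of the exponent lattice. -/
def liftHom {R : Type*} [CommRing R] (g : Multiplicative (I → ℤ) →* R) : Laur I →+* R :=
  (AddMonoidAlgebra.lift ℤ R (I → ℤ) g).toRingHom

theorem liftHom_mon {R : Type*} [CommRing R] (g : Multiplicative (I → ℤ) →* R) (v : I → ℤ) :
    liftHom g (mon v) = g (Multiplicative.ofAdd v) := by
  simp [liftHom, mon]

theorem induction {p : Laur I → Prop} (F : Laur I) (hm : ∀ v, p (mon v))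
    (ha : ∀ F G, p F → p G → p (F + G)) (hs : ∀ (r : ℤ) F, p F → p (r • F)) : p F :=
  AddMonoidAlgebra.induction_on F hm ha hs

/-- The sum of coefficients. -/
def aug : Laur I →+* ℤ := liftHom 1

theorem aug_mon (v : I → ℤ) : aug (mon v) = 1 := by simp [aug, liftHom_mon]

section Fold

variable (u : I → ℤ) (e : I)

/-- The character `v ↦ (-1) ^ (v e) • (v - v e • u)`. -/
def foldChar : Multiplicative (I → ℤ) →* Laur I where
  toFun v := ((((-1 : ℤˣ) ^ (v.toAdd e) : ℤˣ) : ℤ) : Laur I) * mon (v.toAdd - v.toAdd e • u)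
  map_one' := by simp [mon_zero]
  map_mul' v w := by
    -- The character substitutes `-1` for `mon u`; when `u e = 1`, this eliminates the coordinate
    -- `e`.
    have h : v.toAdd + w.toAdd - (v.toAdd e + w.toAdd e) • u
        = (v.toAdd - v.toAdd e • u) + (w.toAdd - w.toAdd e • u) := by
      rw [add_smul]; abel
    simp only [toAdd_mul, Pi.add_apply, zpow_add, Units.val_mul, Int.cast_mul, h, mon_add]
    ring

/-- For `u e = 1`, the ring endomorphism with kernel generated by `1 + mon u`. -/
def fold : Laur I →+* Laur I := liftHom (foldChar u e)

theorem fold_mon (v : I → ℤ) :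
    fold u e (mon v) = ((((-1 : ℤˣ) ^ (v e) : ℤˣ) : ℤ) : Laur I) * mon (v - v e • u) := by
  rw [fold, liftHom_mon]; rfl

theorem one_add_mon_dvd_aux (m : ℤ) :
    1 + mon u ∣ mon (m • u) - ((((-1 : ℤˣ) ^ m : ℤˣ) : ℤ) : Laur I) := by
  have nat : ∀ m : ℕ, 1 + mon u ∣ mon (m • u) - (-1) ^ m := by
    intro m
    rw [← mon_pow]
    have := sub_dvd_pow_sub_pow (mon u) (-1) m
    rwa [sub_neg_eq_add, add_comm] at this
  obtain ⟨k, rfl | rfl⟩ := m.eq_nat_or_neg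
  · simpa using nat k
  · obtain ⟨c, hc⟩ := nat k
    have h1 : mon (-((k : ℤ) • u)) * mon (k • u) = 1 := by
      rw [natCast_zsmul, mul_comm, mon_mul_neg]
    have h2 : ((-1 : Laur I) ^ k) * (-1) ^ k = 1 := by
      rw [← mul_pow]; simp
    refine ⟨-(mon (-((k : ℤ) • u)) * (-1) ^ k * c), ?_⟩
    have h3 : ((((-1 : ℤˣ) ^ (-(k : ℤ)) : ℤˣ) : ℤ) : Laur I) = (-1) ^ k := by
      rw [zpow_neg, ← inv_zpow]; simp
    rw [h3, neg_smul]
    linear_combination -(mon (-((k : ℤ) • u)) * (-1) ^ k) * hc + (-1 : Laur I) ^ k * h1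
      - mon (-((k : ℤ) • u)) * h2

theorem dvd_sub_fold (F : Laur I) : 1 + mon u ∣ F - fold u e F := by
  induction F using Laur.induction with
  | hm v =>
    rw [fold_mon]
    have h : v = (v - v e • u) + v e • u := by abel
    have h2 : mon v = mon (v - v e • u) * mon (v e • u) := by rw [← mon_add, ← h]
    rw [h2, mul_comm _ (mon (v - v e • u)), ← mul_sub]
    exact (one_add_mon_dvd_aux u _).mul_left _
  | ha F G hF hG =>
    have := dvd_add hF hG
    rw [map_add]
    convert this using 1; ring
  | hs r F hF =>
    have := hF.mul_left (r : Laur I)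
    rw [map_zsmul, zsmul_eq_mul, zsmul_eq_mul, ← mul_sub]
    exact this

variable {u e}

theorem fold_one_add_mon (he : u e = 1) : fold u e (1 + mon u) = 0 := by
  simp [fold_mon, he, mon_zero]

theorem dvd_iff_fold_eq_zero (he : u e = 1) (F : Laur I) : 1 + mon u ∣ F ↔ fold u e F = 0 := by
  constructor
  · rintro ⟨c, rfl⟩
    rw [map_mul, fold_one_add_mon he, zero_mul]
  · intro h
    simpa [h] using dvd_sub_fold u e F

theorem one_add_mon_ne_zero (v : I → ℤ) : 1 + mon v ≠ 0 := by
  intro h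
  have := congrArg aug h
  simp [aug_mon] at this

/-- By `dvd_iff_fold_eq_zero`, `fold u e` embeds the quotient by `1 + mon u` into the Laurent ring,
which is a domain. -/
theorem prime_one_add_mon (he : u e = 1) : Prime (1 + mon u) := by
  refine ⟨one_add_mon_ne_zero u, ?_, ?_⟩
  · intro h
    have := h.map (fold u e)
    rw [fold_one_add_mon he] at this
    exact not_isUnit_zero this
  · intro a b h
    rw [dvd_iff_fold_eq_zero he, map_mul, mul_eq_zero] at h
    rwa [dvd_iff_fold_eq_zero he, dvd_iff_fold_eq_zero he]

/-- Divisibility would force `1 ± mon (v - v e • u) = 0`, so `v` would be a multiple of `u`; the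
coordinate `f` excludes this. -/
theorem not_dvd_one_add_mon (he : u e = 1) {v : I → ℤ} {f : I} (hu : u f = 0) (hv : v f ≠ 0) :
    ¬ 1 + mon u ∣ 1 + mon v := by
  rw [dvd_iff_fold_eq_zero he, map_add, map_one, fold_mon]
  intro h
  have key : v - v e • u ≠ 0 := by
    intro h0
    have := congrFun h0 f
    simp [hu] at this
    exact hv this
  -- The sum of coefficients determines the sign.
  have h1 := congrArg aug h
  simp only [map_add, map_one, map_mul, aug_mon, mul_one, map_intCast, map_zero, Int.cast_id] at h1
  rw [show ((((-1 : ℤˣ) ^ (v e) : ℤˣ) : ℤ)) = -1 by omega] at h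
  have h2 : mon (v - v e • u) = mon 0 := by
    rw [mon_zero]; linear_combination (norm := (push_cast; ring)) -h
  exact key (of_injective h2)

end Fold

section Eval

variable [Fintype I] {K : Type*} [Field K]

/-- Evaluation of Laurent polynomials at nonzero elements of a field. -/
def eval (x : I → K) (hx : ∀ i, x i ≠ 0) : Laur I →+* K :=
  liftHom
    { toFun := fun v => ∏ i, x i ^ v.toAdd i
      map_one' := by simp
      map_mul' := fun v w => by
        simp only [toAdd_mul, Pi.add_apply, ← Finset.prod_mul_distrib]
        exact Finset.prod_congr rfl fun i _ => zpow_add₀ (hx i) _ _ }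

theorem eval_mon (x : I → K) (hx : ∀ i, x i ≠ 0) (v : I → ℤ) :
    eval x hx (mon v) = ∏ i, x i ^ v i := by
  rw [eval, liftHom_mon]; rfl

theorem eval_single [DecidableEq I] (x : I → K) (hx : ∀ i, x i ≠ 0) (i : I) :
    eval x hx (mon (Pi.single i 1)) = x i := by
  rw [eval_mon, Finset.prod_eq_single i]
  · simp
  · intro j _ hj; simp [hj]
  · simp

theorem eval_mem (x : I → K) (hx : ∀ i, x i ≠ 0) (S : Subring K) (h1 : ∀ i, x i ∈ S)
    (h2 : ∀ i, (x i)⁻¹ ∈ S) (F : Laur I) : eval x hx F ∈ S := by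
  induction F using Laur.induction with
  | hm v =>
    rw [eval_mon]
    refine Subring.prod_mem _ fun i _ => ?_
    obtain ⟨m, h | h⟩ := (v i).eq_nat_or_neg
    · rw [h, zpow_natCast]; exact Subring.pow_mem _ (h1 i) m
    · rw [h, zpow_neg, zpow_natCast, ← inv_pow]; exact Subring.pow_mem _ (h2 i) m
  | ha F G hF hG => rw [map_add]; exact Subring.add_mem _ hF hG
  | hs r F hF => rw [map_zsmul]; exact Subring.zsmul_mem _ hF r

/-- The elements that some power of `h` multiplies into `S`. -/
def clear (S : Subring K) (h : K) (hS : h ∈ S) : Subring K where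
  carrier := {z | ∃ N : ℕ, h ^ N * z ∈ S}
  zero_mem' := ⟨0, by simp [S.zero_mem]⟩
  one_mem' := ⟨0, by simp [S.one_mem]⟩
  add_mem' := by
    rintro a b ⟨N, hN⟩ ⟨M, hM⟩
    refine ⟨N + M, ?_⟩
    have : h ^ (N + M) * (a + b) = h ^ M * (h ^ N * a) + h ^ N * (h ^ M * b) := by ring
    rw [this]
    exact S.add_mem (S.mul_mem (S.pow_mem hS _) hN) (S.mul_mem (S.pow_mem hS _) hM)
  mul_mem' := by
    rintro a b ⟨N, hN⟩ ⟨M, hM⟩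
    refine ⟨N + M, ?_⟩
    have : h ^ (N + M) * (a * b) = (h ^ N * a) * (h ^ M * b) := by ring
    rw [this]
    exact S.mul_mem hN hM
  neg_mem' := by
    rintro a ⟨N, hN⟩
    exact ⟨N, by rw [mul_neg]; exact S.neg_mem hN⟩

theorem exists_pow_mul_eval_mem (x : I → K) (hx : ∀ i, x i ≠ 0) (S : Subring K) (h : K)
    (hS : h ∈ S) (h1 : ∀ i, x i ∈ S) (h2 : ∀ i, h * (x i)⁻¹ ∈ S) (F : Laur I) :
    ∃ N : ℕ, h ^ N * eval x hx F ∈ S :=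
  eval_mem x hx (clear S h hS) (fun i => ⟨0, by simpa using h1 i⟩)
    (fun i => ⟨1, by simpa using h2 i⟩) F

end Eval

end Laur

/-! ### Matrix mutation along words -/

section Mutation

variable {I : Type} [DecidableEq I]

/-- Matrix mutation, for an arbitrary index type. -/
def mutB (B : Matrix I I ℤ) (k : I) : Matrix I I ℤ := fun i j =>
  if k = i ∨ k = j then -B i j
  else B i j + (max (B i k) 0 * max (B k j) 0 - max (-B i k) 0 * max (-B k j) 0)

/-- |x|y + x|y| is twice x⁺y⁺ − x⁻y⁻. The second form needs no integer division. -/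
theorem mutateArrows_eq_mutB {n : ℕ} (B : Matrix (Fin n) (Fin n) ℤ) (k : Fin n) :
    IceQuiver.mutateArrows B k = mutB B k := by
  funext i j
  unfold IceQuiver.mutateArrows mutB
  split_ifs with h
  · rfl
  · congr 1
    refine Int.ediv_eq_of_eq_mul_left two_ne_zero ?_
    rcases le_total 0 (B i k) with h1 | h1 <;> rcases le_total 0 (B k j) with h2 | h2 <;>
      simp [abs_of_nonneg, abs_of_nonpos, h1, h2] <;> ring

theorem mutB_neg (B : Matrix I I ℤ) (k : I) : mutB (-B) k = -mutB B k := by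
  funext i j
  simp only [mutB, Matrix.neg_apply, neg_neg]
  split_ifs <;> ring

theorem mutB_mutB (B : Matrix I I ℤ) (k : I) :
    mutB (mutB B k) k = B := by
  funext i j
  by_cases h : k = i ∨ k = j
  · simp [mutB, h]
  · simp only [mutB, h, if_false, true_or, or_true, if_true, neg_neg]
    ring

theorem mutB_skew {B : Matrix I I ℤ} (hB : ∀ i j, B j i = -B i j) (k i j : I) :
    mutB B k j i = -mutB B k i j := by
  unfold mutB
  by_cases h : k = i ∨ k = j
  · rw [if_pos h, if_pos h.symm, hB i j]
  · rw [if_neg h, if_neg (fun h' => h h'.symm), hB i j, hB k j, hB i k, neg_neg, neg_neg]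
    ring

/-- The matrix after mutating along a list of vertices, the last entry first. -/
def runB (B : Matrix I I ℤ) : List I → Matrix I I ℤ
  | [] => B
  | k :: w => mutB (runB B w) k

theorem runB_append (B : Matrix I I ℤ) (w' w : List I) :
    runB B (w' ++ w) = runB (runB B w) w' := by
  induction w' with
  | nil => rfl
  | cons k w' ih => simp [runB, ih]

theorem runB_neg (B : Matrix I I ℤ) (w : List I) : runB (-B) w = -runB B w := by
  induction w with
  | nil => rfl
  | cons k w ih => rw [runB, ih, mutB_neg, runB]

theorem runB_skew {B : Matrix I I ℤ} (hB : ∀ i j, B j i = -B i j) (w : List I) :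
    ∀ i j, runB B w j i = -runB B w i j := by
  induction w with
  | nil => exact hB
  | cons k w ih => exact fun i j => mutB_skew ih k i j

theorem runB_cons_cons_self (B : Matrix I I ℤ) (k : I) (w : List I) :
    runB B (k :: k :: w) = runB B w :=
  mutB_mutB _ k

end Mutation

/-! ### Exchange polynomials, cluster mutation and subtraction-free clusters -/

section Exchange

variable {I : Type}

section

variable {K : Type*} [Field K]

/-- There is a set of nonzero elements that contains all `x i` and is closed under the
operations of a semifield. -/
def SubtractionFree (x : I → K) : Prop :=
  ∃ P : Set K, 0 ∉ P ∧ 1 ∈ P ∧ (∀ a ∈ P, ∀ b ∈ P, a + b ∈ P) ∧ (∀ a ∈ P, ∀ b ∈ P, a * b ∈ P) ∧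
    (∀ a ∈ P, a⁻¹ ∈ P) ∧ ∀ i, x i ∈ P

namespace SubtractionFree

theorem ne_zero {x : I → K} (h : SubtractionFree x) (i : I) : x i ≠ 0 := by
  obtain ⟨P, h0, -, -, -, -, hx⟩ := h
  exact fun hi => h0 (hi ▸ hx i)

/-- The semifield consists of the fractions whose numerator and denominator have positive image
under `ε`. Subtraction-freeness persists under mutation and keeps variables and exchange polynomials
nonzero, so the default value of `0⁻¹` never interferes. -/
theorem of_hom {A : Type*} [CommRing A] (ε : A →+* ℚ) (ι : A →+* K)
    (hι : Function.Injective ι) (X : I → A) (hX : ∀ i, 0 < ε (X i)) :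
    SubtractionFree fun i => ι (X i) := by
  have hne : ∀ a, 0 < ε a → ι a ≠ 0 := by
    intro a ha h0
    rw [map_eq_zero_iff ι hι] at h0
    simp [h0] at ha
  refine ⟨{z | ∃ a b, 0 < ε a ∧ 0 < ε b ∧ z = ι a / ι b}, ?_, ⟨1, 1, by simp⟩, ?_, ?_, ?_, ?_⟩
  · rintro ⟨a, b, ha, hb, h⟩
    exact div_ne_zero (hne a ha) (hne b hb) h.symm
  · rintro _ ⟨a, b, ha, hb, rfl⟩ _ ⟨c, d, hc, hd, rfl⟩
    refine ⟨a * d + b * c, b * d, by rw [map_add, map_mul, map_mul]; positivity,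
      by rw [map_mul]; positivity, ?_⟩
    rw [div_add_div _ _ (hne b hb) (hne d hd)]; simp
  · rintro _ ⟨a, b, ha, hb, rfl⟩ _ ⟨c, d, hc, hd, rfl⟩
    refine ⟨a * c, b * d, by rw [map_mul]; positivity, by rw [map_mul]; positivity, ?_⟩
    rw [div_mul_div_comm]; simp
  · rintro _ ⟨a, b, ha, hb, rfl⟩
    exact ⟨b, a, hb, ha, by rw [inv_div]⟩
  · exact fun i => ⟨X i, 1, hX i, by simp, by simp⟩

end SubtractionFree

end

section

variable [Fintype I] {K : Type*} [Field K]

/-- The right-hand side of the exchange relation at `k`. -/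
def exch {R : Type*} [CommSemiring R] (B : Matrix I I ℤ) (x : I → R) (k : I) : R :=
  ∏ j, x j ^ (B k j).toNat + ∏ j, x j ^ (-B k j).toNat

theorem exch_neg {R : Type*} [CommSemiring R] (B : Matrix I I ℤ) (x : I → R) (k : I) :
    exch (-B) x k = exch B x k := by
  simp [exch, add_comm]

theorem map_exch {R S : Type*} [CommSemiring R] [CommSemiring S] (f : R →+* S)
    (B : Matrix I I ℤ) (x : I → R) (k : I) : f (exch B x k) = exch B (f ∘ x) k := by
  simp [exch, map_add, map_prod]

theorem exch_mem {x : I → K} {P : Set K} (h1 : 1 ∈ P) (ha : ∀ a ∈ P, ∀ b ∈ P, a + b ∈ P)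
    (hm : ∀ a ∈ P, ∀ b ∈ P, a * b ∈ P) (hx : ∀ i, x i ∈ P) (B : Matrix I I ℤ) (k : I) :
    exch B x k ∈ P := by
  let S : Submonoid K := { carrier := P, one_mem' := h1, mul_mem' := fun {a b} h h' => hm a h b h' }
  exact ha _ (S.prod_mem fun i _ => S.pow_mem (hx i) _) _
    (S.prod_mem fun i _ => S.pow_mem (hx i) _)

theorem SubtractionFree.exch_ne_zero {x : I → K} (h : SubtractionFree x) (B : Matrix I I ℤ)
    (k : I) :
    exch B x k ≠ 0 := by
  obtain ⟨P, h0, h1, ha, hm, -, hx⟩ := h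
  exact fun hi => h0 (hi ▸ exch_mem h1 ha hm hx B k)

theorem exch_congr {R : Type*} [CommSemiring R] (B : Matrix I I ℤ) {x y : I → R} {k : I}
    (hB : B k k = 0) (h : ∀ j, j ≠ k → x j = y j) : exch B x k = exch B y k := by
  unfold exch
  congr 1 <;> refine Finset.prod_congr rfl fun j _ => ?_ <;> by_cases hj : j = k
  · simp [hj, hB]
  · rw [h j hj]
  · simp [hj, hB]
  · rw [h j hj]

end

variable [DecidableEq I] [Fintype I] {K : Type*} [Field K]

/-- Mutation of a cluster. -/
def mutX (B : Matrix I I ℤ) (x : I → K) (k : I) : I → K :=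
  Function.update x k (exch B x k * (x k)⁻¹)

theorem mutX_neg (B : Matrix I I ℤ) (x : I → K) (k : I) : mutX (-B) x k = mutX B x k := by
  rw [mutX, exch_neg, mutX]

theorem exch_mutB (B : Matrix I I ℤ) (x : I → K) (k : I) : exch (mutB B k) x k = exch B x k := by
  have : ∀ j, mutB B k k j = -B k j := fun j => by simp [mutB]
  simp [exch, this, add_comm]

theorem mutX_mutX {B : Matrix I I ℤ} (hB : ∀ i j, B j i = -B i j) {x : I → K} {k : I}
    (hx : x k ≠ 0) (he : exch B x k ≠ 0) : mutX (mutB B k) (mutX B x k) k = x := by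
  have hkk : B k k = 0 := by have := hB k k; omega
  funext i
  by_cases h : i = k
  · subst h
    rw [mutX, Function.update_self, exch_mutB]
    rw [exch_congr B hkk (y := x) (fun j hj => by simp [mutX, hj])]
    simp only [mutX, Function.update_self]
    field_simp
  · simp [mutX, h]

/-- The cluster after mutating along a list of vertices, the last entry first. -/
def runX (B : Matrix I I ℤ) (x : I → K) : List I → I → K
  | [] => x
  | k :: w => mutX (runB B w) (runX B x w) k

theorem runX_append (B : Matrix I I ℤ) (x : I → K) (w' w : List I) :
    runX B x (w' ++ w) = runX (runB B w) (runX B x w) w' := by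
  induction w' with
  | nil => rfl
  | cons k w' ih => simp [runX, ih, runB_append]

theorem runX_neg (B : Matrix I I ℤ) (x : I → K) (w : List I) : runX (-B) x w = runX B x w := by
  induction w with
  | nil => rfl
  | cons k w ih => rw [runX, ih, runB_neg, mutX_neg, runX]

namespace SubtractionFree

theorem mutX {x : I → K} (h : SubtractionFree x) (B : Matrix I I ℤ) (k : I) :
    SubtractionFree (mutX B x k) := by
  obtain ⟨P, h0, h1, ha, hm, hi, hx⟩ := h
  refine ⟨P, h0, h1, ha, hm, hi, fun i => ?_⟩
  by_cases hik : i = k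
  · subst hik
    simpa [ClusterAlg.mutX] using hm _ (exch_mem h1 ha hm hx B i) _ (hi _ (hx i))
  · simpa [ClusterAlg.mutX, hik] using hx i

theorem runX {x : I → K} (h : SubtractionFree x) (B : Matrix I I ℤ) (w : List I) :
    SubtractionFree (runX B x w) := by
  induction w with
  | nil => exact h
  | cons k w ih => exact ih.mutX _ k

end SubtractionFree

theorem runX_cons_cons_self {B : Matrix I I ℤ} (hB : ∀ i j, B j i = -B i j) {x : I → K}
    (hx : SubtractionFree x) (k : I) (w : List I) : runX B x (k :: k :: w) = runX B x w :=
  mutX_mutX (runB_skew hB w) ((hx.runX B w).ne_zero k) ((hx.runX B w).exch_ne_zero _ k)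

end Exchange

/-! ### The universal cluster and its specializations -/

section Universal

variable (I : Type) [DecidableEq I]

/-- The field of fractions of the Laurent polynomial ring. -/
abbrev LaurFrac : Type := FractionRing (Laur I)

/-- The variables, as elements of `LaurFrac I`. -/
def univX : I → LaurFrac I := fun i => algebraMap (Laur I) (LaurFrac I) (Laur.mon (Pi.single i 1))

theorem subtractionFree_univX : SubtractionFree (univX I) :=
  SubtractionFree.of_hom ((Int.castRingHom ℚ).comp Laur.aug) (algebraMap (Laur I) (LaurFrac I))
    (IsFractionRing.injective _ _) (fun i => Laur.mon (Pi.single i 1)) (by simp [Laur.aug_mon])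

variable {I} [Fintype I]

/-- Mutating the universal cluster along `w` gives Laurent polynomials. -/
def IsLaurent (B : Matrix I I ℤ) (w : List I) : Prop :=
  ∀ i, runX B (univX I) w i ∈ (algebraMap (Laur I) (LaurFrac I)).range

/-- Laurent formulas for the universal cluster specialize to any subtraction-free cluster in any
field. All suffixes of `w` must be Laurent, because the induction evaluates each intermediate
exchange relation. -/
theorem exists_eval_eq_runX {B : Matrix I I ℤ} {w : List I}
    (h : ∀ w', w' <:+ w → IsLaurent B w') {K : Type*} [Field K] {x : I → K}
    (hx : SubtractionFree x) (i : I) :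
    ∃ F : Laur I, algebraMap (Laur I) (LaurFrac I) F = runX B (univX I) w i ∧
      Laur.eval x hx.ne_zero F = runX B x w i := by
  induction w generalizing i with
  | nil => exact ⟨Laur.mon (Pi.single i 1), rfl, Laur.eval_single x _ i⟩
  | cons k w ih =>
    have ih := ih fun w' hw' => h w' (hw'.trans (List.suffix_cons k w))
    by_cases hik : i = k
    · subst hik
      choose G hG1 hG2 using ih
      obtain ⟨F, hF⟩ := h _ List.suffix_rfl i
      refine ⟨F, hF, ?_⟩
      have hu := (subtractionFree_univX I).runX B w
      -- The exchange relation is moved from the fraction field to the Laurent ring, where it is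
      -- free of division and can be evaluated.
      have hrel : F * G i = exch (runB B w) G i := by
        apply IsFractionRing.injective (Laur I) (LaurFrac I)
        rw [map_mul, hF, map_exch, hG1, show _ ∘ G = runX B (univX I) w from funext hG1, runX, mutX,
          Function.update_self, inv_mul_cancel_right₀ (hu.ne_zero i)]
      have h2 := congrArg (Laur.eval x hx.ne_zero) hrel
      rw [map_mul, map_exch, hG2] at h2
      rw [runX, mutX, Function.update_self, eq_mul_inv_iff_mul_eq₀ ((hx.runX B w).ne_zero i), h2]
      congr 1
      exact funext hG2
    · simpa [runX, mutX, hik] using ih i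

end Universal

/-! ### The Laurent phenomenon -/

/-- The algebra behind two successive mutations in rank two: `c = C / x` is the value of `q`
modulo `p`. -/
theorem exists_mul_eq_mul_pow_add {R : Type*} [CommRing R] {p q c a D E u : R}
    (b : ℕ) (hq : q = p ^ b * a + c) (hu : D * c ^ b + E = u * p) :
    ∃ r, r * p = D * q ^ b + E ∧ ((b = 1 ∧ r = u + D * a) ∨ p ∣ r - u) := by
  -- For `b = 0` the powers of `q` and `c` agree. For `b = 1` the correction to `u` is exactly `D *
  -- a`. For `b ≥ 2`, `p ^ b` divides `q - c`, so after division by `p` the correction is still a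
  -- multiple of `p`.
  rcases b with _ | _ | b
  · exact ⟨u, by simpa using hu.symm, Or.inr (by simp)⟩
  · refine ⟨u + D * a, ?_, Or.inl ⟨rfl, rfl⟩⟩
    rw [hq]
    linear_combination -hu
  · obtain ⟨d, hd⟩ := sub_dvd_pow_sub_pow q c (b + 2)
    refine ⟨u + D * (p ^ (b + 1) * a * d), ?_, Or.inr ?_⟩
    · have h1 : q - c = p ^ (b + 2) * a := by rw [hq]; ring
      rw [h1] at hd
      linear_combination -hu - D * hd
    · exact ⟨D * (p ^ b * a * d), by ring⟩

/-- Only this much of unique factorization is needed: a fraction with denominators `p ^ N` and `h ^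
M`, where the prime `p` does not divide `h`, is integral. -/
theorem mem_range_of_pow_mul_mem {R K : Type*} [CommRing R] [IsDomain R] [Field K] [Algebra R K]
    [IsFractionRing R K] {p h : R} (hp : Prime p) (hh : ¬ p ∣ h) {z : K} {N M : ℕ}
    (h1 : algebraMap R K p ^ N * z ∈ (algebraMap R K).range)
    (h2 : algebraMap R K h ^ M * z ∈ (algebraMap R K).range) : z ∈ (algebraMap R K).range := by
  obtain ⟨F, hF⟩ := h1
  obtain ⟨G, hG⟩ := h2
  have hFG : F * h ^ M = p ^ N * G := by
    apply IsFractionRing.injective R K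
    simp only [map_mul, map_pow, hF, hG]
    ring
  obtain ⟨c, hc⟩ := hp.pow_dvd_of_dvd_mul_right N (fun hd => hh (hp.dvd_of_dvd_pow hd))
    (Dvd.intro _ hFG.symm)
  refine ⟨c, ?_⟩
  have hp0 : algebraMap R K p ≠ 0 := by
    rw [Ne, map_eq_zero_iff _ (IsFractionRing.injective R K)]; exact hp.ne_zero
  have := pow_ne_zero N hp0
  apply mul_left_cancel₀ this
  rw [← hF, hc, map_mul, map_pow]

section Frame

variable {I : Type} [DecidableEq I]

/-- The matrix `B` with an extra vertex `inr i` and a single arrow `inl i → inr i` for each `i`. -/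
def frameB (B : Matrix I I ℤ) : Matrix (I ⊕ I) (I ⊕ I) ℤ := Matrix.fromBlocks B 1 (-1) 0

theorem frameB_skew {B : Matrix I I ℤ} (hB : ∀ i j, B j i = -B i j) (i j : I ⊕ I) :
    frameB B j i = -frameB B i j := by
  rcases i with i | i <;> rcases j with j | j <;>
    simp [frameB, Matrix.one_apply, eq_comm, hB i j]

theorem runB_inl {J : Type} [DecidableEq J] {C : Matrix (I ⊕ J) (I ⊕ J) ℤ} {B : Matrix I I ℤ}
    (h : ∀ i j, C (.inl i) (.inl j) = B i j) (w : List I) (i j : I) :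
    runB C (w.map .inl) (.inl i) (.inl j) = runB B w i j := by
  induction w generalizing i j with
  | nil => exact h i j
  | cons k w ih => simp [runB, mutB, ih]

end Frame

section Universal

variable {I : Type} [DecidableEq I] [Fintype I]

theorem prod_pow_eq_mon {j k : I} (hjk : j ≠ k) (y : I → Laur I)
    (hy : ∀ i, i ≠ j → i ≠ k → y i = Laur.mon (Pi.single i 1)) (m : I → ℕ) :
    ∏ i, y i ^ m i = y j ^ m j * y k ^ m k *
      Laur.mon (fun i => if i = j ∨ i = k then 0 else (m i : ℤ)) := by
  classical
  have hmon : ∀ (s : Finset I), ∏ i ∈ s, Laur.mon (Pi.single i (1 : ℤ)) ^ m i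
      = Laur.mon (fun i => if i ∈ s then (m i : ℤ) else 0) := by
    intro s
    induction s using Finset.induction_on with
    | empty => simp [← Laur.mon_zero]; rfl
    | insert a s ha ih =>
      rw [Finset.prod_insert ha, ih, Laur.mon_pow, ← Laur.mon_add]
      congr 1
      funext i
      by_cases hi : i = a
      · subst hi; simp [ha]
      · simp [hi]
  rw [← Finset.mul_prod_erase _ _ (Finset.mem_univ j),
    ← Finset.mul_prod_erase _ _ (Finset.mem_erase.2 ⟨hjk.symm, Finset.mem_univ k⟩), mul_assoc]
  congr 2
  rw [Finset.prod_congr rfl (g := fun i => Laur.mon (Pi.single i (1 : ℤ)) ^ m i), hmon]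
  · congr 1
    funext i
    by_cases h1 : i = j <;> by_cases h2 : i = k <;> simp [h1, h2]
  · intro i hi
    simp only [Finset.mem_erase, Finset.mem_univ, and_true] at hi
    rw [hy i hi.2 hi.1]


/-- Three alternating mutations of the universal cluster in the directions `j`, `k`, `j`, in the
presence of two vertices `e`, `f` that make the two exchange polynomials generic. -/
theorem exists_alternating_mutation {B : Matrix I I ℤ} (hB : ∀ i j, B j i = -B i j) {j k e f : I}
    (hjk : j ≠ k) (hb : 0 ≤ B j k) (hje : B j e = 1) (hfj : f ≠ j) (hfk : f ≠ k)
    (hjf : B j f = 0) (hkf : B k f = 1) :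
    ∃ p q r : Laur I, Prime p ∧ ¬ p ∣ q * r ∧
      runX B (univX I) [j] = Function.update (univX I) j (algebraMap (Laur I) (LaurFrac I) p) ∧
      runX B (univX I) [j, k, j] = Function.update (Function.update (univX I) k
        (algebraMap (Laur I) (LaurFrac I) q)) j (algebraMap (Laur I) (LaurFrac I) r) := by
  have hkj := hjk.symm
  have hjj : B j j = 0 := by have := hB j j; omega
  have hkk : B k k = 0 := by have := hB k k; omega
  have hBkj := hB j k
  obtain ⟨b, hbn⟩ := Int.eq_ofNat_of_zero_le hb
  -- Positive part of an exponent vector away from `j` and `k`; those two coordinates are treated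
  -- apart because their variables stop being monomials.
  let ρ : (I → ℤ) → I → ℤ := fun v i => if i = j ∨ i = k then 0 else ((v i).toNat : ℤ)
  let ε : I → I → ℤ := fun i => Pi.single i 1
  let X : I → Laur I := fun i => Laur.mon (ε i)
  let B₁ := mutB B j
  let B₂ := mutB B₁ k
  have hB₁k : ∀ i, i ≠ j → B₁ k i = B k i - b * max (-B j i) 0 := by
    intro i hi
    simp only [B₁, mutB, hjk, hi.symm, or_self, if_false]
    rw [hBkj, hbn, max_eq_right (by omega : -(b : ℤ) ≤ 0), neg_neg,
      max_eq_left (by omega : (0 : ℤ) ≤ b)]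
    ring
  have hB₁kj : B₁ k j = b := by simp [B₁, mutB, hBkj, hbn]
  have hB₁jk : B₁ j k = -b := by simp [B₁, mutB, hbn]
  have hB₁j : ∀ i, B₁ j i = -B j i := by simp [B₁, mutB]
  have hB₂j : ∀ i, i ≠ k → B₂ j i = -B j i - b * max (-B₁ k i) 0 := by
    intro i hi
    simp only [B₂]
    rw [mutB, if_neg (by simp [hkj, hi.symm]), hB₁jk, max_eq_right (by omega : -(b : ℤ) ≤ 0),
      neg_neg, max_eq_left (by omega : (0 : ℤ) ≤ b), hB₁j]
    ring
  have hB₂jk : B₂ j k = b := by simp [B₂, mutB, hB₁jk]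
  have hB₂jj : B₂ j j = 0 := by rw [hB₂j j hjk, hjj, hB₁kj]; simp
  have hB₁kk : B₁ k k = 0 := by rw [hB₁k k hkj, hkk, hbn]; simp
  have hexch : ∀ (y : I → Laur I), (∀ i, i ≠ j → i ≠ k → y i = Laur.mon (Pi.single i 1)) →
      ∀ (C : Matrix I I ℤ) (i : I), exch C y i =
        y j ^ (C i j).toNat * y k ^ (C i k).toNat * Laur.mon (ρ (C i)) +
        y j ^ (-C i j).toNat * y k ^ (-C i k).toNat * Laur.mon (ρ (-C i)) := by
    intro y hy C i
    rw [exch, prod_pow_eq_mon hjk y hy, prod_pow_eq_mon hjk y hy]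
    rfl
  have hb1 : (-(b : ℤ)).toNat = 0 := by omega
  let p : Laur I := Laur.mon (-ε j) * exch B X j
  have hp : p = Laur.mon (-ε j + b • ε k + ρ (B j)) + Laur.mon (-ε j + ρ (-B j)) := by
    simp only [p]
    have hXk : Laur.mon (b • ε k) = X k ^ b := (Laur.mon_pow _ _).symm
    rw [hexch X (fun _ _ _ => rfl), hjj, hbn, hb1, Laur.mon_add, Laur.mon_add, Laur.mon_add, hXk]
    simp only [Int.toNat_zero, neg_zero, pow_zero, Int.toNat_natCast]
    ring
  have hBj : b • ε k + ρ (B j) - ρ (-B j) = B j := by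
    funext i
    by_cases h1 : i = j
    · subst h1; simp [ε, ρ, hjj, hjk]
    by_cases h2 : i = k
    · subst h2; simp [ε, ρ, hbn]
    · simp only [ε, ρ, Pi.add_apply, Pi.sub_apply, Pi.smul_apply, h1, h2, Pi.neg_apply, or_self,
        if_false, Pi.single_eq_of_ne h2, smul_zero]
      omega
  have hp' : p = Laur.mon (-ε j + ρ (-B j)) * (1 + Laur.mon (B j)) := by
    rw [hp, mul_add, mul_one, ← Laur.mon_add, add_comm]
    congr 2
    linear_combination hBj
  have hpdvd : ∀ F, p ∣ F ↔ 1 + Laur.mon (B j) ∣ F := by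
    intro F
    rw [hp', (Laur.isUnit_mon _).mul_left_dvd]
  have hprime : Prime p := by
    rw [hp']
    have := Laur.prime_one_add_mon (u := B j) hje
    exact (associated_unit_mul_left _ _ (Laur.isUnit_mon _)).symm.prime this
  have hpu : ∀ v, ¬ p ∣ Laur.mon v :=
    fun v hv => hprime.not_isUnit (isUnit_of_dvd_unit hv (Laur.isUnit_mon v))
  have hpv : ∀ w v : I → ℤ, v f ≠ 0 → ¬ p ∣ Laur.mon w * (1 + Laur.mon v) := by
    intro w v hv
    rw [(Laur.isUnit_mon w).dvd_mul_left, hpdvd]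
    exact Laur.not_dvd_one_add_mon hje hjf hv
  let y₁ := Function.update X j p
  have hy₁ : ∀ i, i ≠ j → y₁ i = X i := fun i hi => by simp [y₁, hi]
  let q : Laur I := Laur.mon (-ε k) * exch B₁ y₁ k
  have hq : q = p ^ b * Laur.mon (-ε k + ρ (B₁ k)) + Laur.mon (-ε k + ρ (-B₁ k)) := by
    simp only [q]
    rw [hexch y₁ (fun i h1 _ => hy₁ i h1), hB₁kj, hB₁kk, hb1, Laur.mon_add, Laur.mon_add]
    simp only [Int.toNat_zero, neg_zero, pow_zero, Int.toNat_natCast, y₁, Function.update_self]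
    ring
  let u : I → ℤ := ρ (-B₂ j) + ε j - b • ε k - ρ (B j)
  -- The matrix mutation rule enters here: once `q` is replaced by its second summand, to which it
  -- is congruent modulo `p ^ b`, the exchange binomial at `j` becomes the monomial `mon u` times
  -- `p`.
  have hexp : ρ (B₂ j) + b • (-ε k + ρ (-B₁ k)) = ρ (-B₂ j) + ρ (-B j) - b • ε k - ρ (B j) := by
    funext i
    by_cases h1 : i = j
    · subst h1; simp [ε, ρ, hjk]
    by_cases h2 : i = k
    · subst h2; simp [ε, ρ]
    · have := hB₂j i h2
      have h3 : max (-B₁ k i) 0 = ((-B₁ k i).toNat : ℤ) := by omega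
      rw [h3] at this
      simp only [ε, ρ, Pi.add_apply, Pi.sub_apply, Pi.smul_apply, h1, h2, Pi.neg_apply, or_self,
        if_false, Pi.single_eq_of_ne h2, smul_zero, neg_zero, zero_add]
      rw [nsmul_eq_mul]
      generalize (b : ℤ) * ((-B₁ k i).toNat : ℤ) = t at this ⊢
      omega
  have hu : Laur.mon (ρ (B₂ j)) * Laur.mon (-ε k + ρ (-B₁ k)) ^ b + Laur.mon (ρ (-B₂ j))
      = Laur.mon u * p := by
    rw [hp, mul_add, Laur.mon_pow, ← Laur.mon_add, ← Laur.mon_add, ← Laur.mon_add, hexp, add_comm]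
    congr 2 <;> simp only [u] <;> abel
  obtain ⟨r, hr, hr'⟩ := exists_mul_eq_mul_pow_add b hq hu
  have hB₁kf : B₁ k f = 1 := by rw [hB₁k f hfj, hkf, hjf]; simp
  have hB₂jf : B₂ j f = 0 := by rw [hB₂j f hfk, hjf, hB₁kf]; simp
  have hρ : ∀ v : I → ℤ, ρ v f = (v f).toNat := fun v => by simp [ρ, hfj, hfk]
  have hεj : ε j f = 0 := by simp [ε, hfj]
  have hεk : ε k f = 0 := by simp [ε, hfk]
  let φ := algebraMap (Laur I) (LaurFrac I)
  have hX0 : ∀ i, φ (X i) ≠ 0 := (subtractionFree_univX I).ne_zero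
  have hφneg : ∀ i, φ (Laur.mon (-ε i)) = (φ (X i))⁻¹ := fun i =>
    eq_inv_of_mul_eq_one_right (by rw [← map_mul, Laur.mon_mul_neg, map_one])
  have hrun₁ : runX B (univX I) [j] = φ ∘ y₁ := by
    funext i
    by_cases hi : i = j
    · subst hi
      simp only [runX, runB, mutX, y₁, p, Function.comp, Function.update_self, map_mul, hφneg,
        map_exch]
      exact mul_comm _ _
    · simp [runX, mutX, hi, y₁]; rfl
  let y₂ := Function.update y₁ k q
  have hrun₂ : runX B (univX I) [k, j] = φ ∘ y₂ := by
    change mutX B₁ (runX B (univX I) [j]) k = _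
    rw [hrun₁]
    funext i
    by_cases hi : i = k
    · subst hi
      simp only [mutX, y₂, q, Function.comp, Function.update_self, map_mul, hφneg, map_exch]
      rw [hy₁ i hkj]
      exact mul_comm _ _
    · simp [mutX, hi, y₂]
  have hy₂ : exch B₂ y₂ j = r * p := by
    rw [hr, hexch y₂ (fun i h1 h2 => by simp [y₂, y₁, h1, h2, X, ε]), hB₂jj, hB₂jk, hb1]
    simp only [Int.toNat_zero, neg_zero, pow_zero, Int.toNat_natCast, y₂, Function.update_self]
    ring
  have hy₂j : y₂ j = p := by simp [y₂, y₁, hjk]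
  have hφp : φ p ≠ 0 := by
    rw [Ne, map_eq_zero_iff _ (IsFractionRing.injective _ _)]
    exact hprime.ne_zero
  refine ⟨p, q, r, hprime, fun h => ?_, ?_, ?_⟩
  -- Modulo `p`, `q` is a monomial unless `b = 0`, and `r` is one unless `b = 1`. In the exceptional
  -- cases they are binomials whose two exponents differ at `f`, where the row `B j` is zero, so `p`
  -- cannot divide them.
  · rcases hprime.dvd_or_dvd h with h | h
    · rcases Nat.eq_zero_or_pos b with h0 | h0
      · refine hpv (-ε k + ρ (-B₁ k)) (ρ (B₁ k) - ρ (-B₁ k)) ?_ ?_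
        · simp [hρ, hB₁kf]
        · convert h using 1
          rw [hq, h0, mul_add, ← Laur.mon_add, add_comm, pow_zero, one_mul, mul_one]
          congr 2
          abel
      · rw [hq, dvd_add_right ((dvd_pow_self p h0.ne').mul_right _)] at h
        exact hpu _ h
    · rcases hr' with ⟨-, hr'⟩ | hr'
      · refine hpv u (ρ (B₂ j) + (-ε k + ρ (B₁ k)) - u) ?_ ?_
        · simp [u, hρ, hB₁kf, hB₂jf, hεj, hεk, hjf]
        · convert h using 1
          rw [hr', mul_add, ← Laur.mon_add, ← Laur.mon_add, mul_one]
          congr 2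
          abel
      · rw [dvd_sub_right h] at hr'
        exact hpu _ hr'
  · rw [hrun₁]
    exact Function.comp_update _ _ _ _
  · change mutX B₂ (runX B (univX I) [k, j]) j = _
    rw [hrun₂, mutX, ← map_exch, hy₂, Function.comp_apply, hy₂j, map_mul,
      mul_inv_cancel_right₀ hφp]
    simp only [y₂, y₁, Function.comp_update]
    rw [Function.update_comm hjk, Function.update_idem]
    rfl

theorem runX_inl {J : Type} [DecidableEq J] [Fintype J] {C : Matrix (I ⊕ J) (I ⊕ J) ℤ}
    {B : Matrix I I ℤ} (h : ∀ i j, C (.inl i) (.inl j) = B i j) {K : Type*} [Field K] (x : I → K)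
    (w : List I) :
    runX C (Sum.elim x fun _ => 1) (w.map .inl) = Sum.elim (runX B x w) fun _ => 1 := by
  induction w with
  | nil => rfl
  | cons k w ih =>
    funext i
    simp only [List.map_cons, runX, ih, mutX]
    rcases i with i | i
    · by_cases hi : i = k
      · subst hi
        simp [exch, runB_inl h]
      · simp [hi]
    · simp

theorem SubtractionFree.sum_elim_one {I J : Type} {K : Type*} [Field K] {x : I → K}
    (h : SubtractionFree x) : SubtractionFree (Sum.elim x fun _ : J => 1) := by
  obtain ⟨P, h0, h1, ha, hm, hi, hx⟩ := h
  exact ⟨P, h0, h1, ha, hm, hi, Sum.rec hx fun _ => h1⟩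

/-- Setting the extra variables to `1` recovers the original clusters and preserves Laurentness. -/
theorem isLaurent_of_frameB {B : Matrix I I ℤ} {w : List I}
    (h : ∀ w', w' <:+ w → IsLaurent (frameB B) (w'.map .inl)) : IsLaurent B w := by
  intro i
  have hx := (subtractionFree_univX I).sum_elim_one (J := I)
  obtain ⟨F, -, hF⟩ := exists_eval_eq_runX (B := frameB B) (w := w.map .inl) (fun w' hw' => by
    obtain ⟨w'', hw'', rfl⟩ := List.suffix_map_iff.1 hw'
    exact h w'' hw'') hx (.inl i)
  rw [runX_inl (B := B) (fun _ _ => rfl)] at hF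
  rw [Sum.elim_inl] at hF
  rw [← hF]
  refine Laur.eval_mem _ _ _ ?_ ?_ F
  · rintro (i | i)
    · exact ⟨_, rfl⟩
    · exact Subring.one_mem _
  · rintro (i | i)
    · exact ⟨Laur.mon (-Pi.single i 1), eq_inv_of_mul_eq_one_right (by
        rw [Sum.elim_inl, univX, ← map_mul, Laur.mon_mul_neg, map_one])⟩
    · simp

theorem isLaurent_append_of_generic {B : Matrix I I ℤ} (hB : ∀ i j, B j i = -B i j) {j k e f : I}
    (hjk : j ≠ k) (hb : 0 ≤ B j k) (hje : B j e = 1) (hfj : f ≠ j) (hfk : f ≠ k)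
    (hjf : B j f = 0) (hkf : B k f = 1) (w : List I)
    (ih : ∀ (C : Matrix I I ℤ), (∀ i j, C j i = -C i j) → ∀ w' : List I, w'.length < w.length + 2 →
      IsLaurent C w') : IsLaurent B (w ++ [k, j]) := by
  intro i
  obtain ⟨p, q, r, hp, hpqr, h1, h3⟩ := exists_alternating_mutation hB hjk hb hje hfj hfk hjf hkf
  have hX := subtractionFree_univX I
  let φ := algebraMap (Laur I) (LaurFrac I)
  -- The target is Laurent in the cluster reached by `v`, since `w'` is shorter; if `h` clears the
  -- inverses of that cluster, a power of `h` clears the target.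
  have hpow : ∀ (v w' : List I) (h : Laur I),
      runX B (univX I) (w' ++ v) = runX B (univX I) (w ++ [k, j]) →
      w'.length < w.length + 2 →
      (∀ i, runX B (univX I) v i ∈ φ.range) → (∀ i, φ h * (runX B (univX I) v i)⁻¹ ∈ φ.range) →
      ∃ N : ℕ, φ h ^ N * runX B (univX I) (w ++ [k, j]) i ∈ φ.range := by
    intro v w' h hrun hlen hv hv'
    obtain ⟨F, -, hF⟩ := exists_eval_eq_runX (B := runB B v) (w := w') (fun w'' hw'' =>
      ih _ (runB_skew hB v) w'' (hw''.length_le.trans_lt hlen)) (hX.runX B v) i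
    rw [← runX_append, hrun] at hF
    rw [← hF]
    exact Laur.exists_pow_mul_eval_mem _ _ φ.range (φ h) ⟨h, rfl⟩ hv hv' F
  have hXi : ∀ (i : I) (h : Laur I), φ h * (univX I i)⁻¹ ∈ φ.range := fun i h =>
    ⟨h * Laur.mon (-Pi.single i 1), by
      rw [map_mul]
      congr 1
      exact eq_inv_of_mul_eq_one_right (by rw [univX, ← map_mul, Laur.mon_mul_neg, map_one])⟩
  have hne : ∀ v i, runX B (univX I) v i ≠ 0 := fun v => (hX.runX B v).ne_zero
  obtain ⟨N, hN⟩ := hpow [j] (w ++ [k]) p (by simp) (by simp) (fun i => by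
      rw [h1]
      by_cases hi : i = j
      · subst hi; exact ⟨p, by simp [φ]⟩
      · exact ⟨_, by rw [Function.update_of_ne hi]; rfl⟩) (fun i => by
      by_cases hi : i = j
      · subst hi
        have := hne [i] i
        rw [h1, Function.update_self] at this ⊢
        rw [mul_inv_cancel₀ this]
        exact Subring.one_mem _
      · rw [h1, Function.update_of_ne hi]
        exact hXi i p)
  -- Starting from `[j, k, j]`, the word `w ++ [j]` first undoes the last mutation at `j`, so the
  -- target is the same and the remaining word is one letter shorter.
  obtain ⟨M, hM⟩ := hpow [j, k, j] (w ++ [j]) (q * r) (by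
      rw [List.append_assoc, runX_append, List.singleton_append, runX_cons_cons_self hB hX,
        runB_cons_cons_self, runX_append]) (by simp) (fun i => by
      rw [h3]
      by_cases hi : i = j
      · subst hi; exact ⟨r, by simp [φ]⟩
      · rw [Function.update_of_ne hi]
        by_cases hk : i = k
        · subst hk; exact ⟨q, by simp [φ]⟩
        · exact ⟨_, by rw [Function.update_of_ne hk]; rfl⟩) (fun i => by
      by_cases hi : i = j
      · subst hi
        have := hne [i, k, i] i
        rw [h3, Function.update_self] at this ⊢
        exact ⟨q, by rw [map_mul, mul_inv_cancel_right₀ this]⟩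
      · by_cases hk : i = k
        · subst hk
          have := hne [j, i, j] i
          rw [h3, Function.update_of_ne hi, Function.update_self] at this ⊢
          exact ⟨r, by rw [mul_comm q, map_mul, mul_inv_cancel_right₀ this]⟩
        · rw [h3, Function.update_of_ne hi, Function.update_of_ne hk]
          exact hXi i _)
  exact mem_range_of_pow_mul_mem hp hpqr hN hM

end Universal

/-- The Laurent phenomenon: every mutation of the universal cluster consists of Laurent
polynomials. -/
theorem isLaurent {I : Type} [DecidableEq I] [Fintype I] {B : Matrix I I ℤ}
    (hB : ∀ i j, B j i = -B i j) (w : List I) : IsLaurent B w := by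
  induction hd : w.length using Nat.strong_induction_on generalizing I with
  | _ d ih =>
  rcases w.eq_nil_or_concat with rfl | ⟨w, j, rfl⟩
  · exact fun i => ⟨_, rfl⟩
  rcases w.eq_nil_or_concat with rfl | ⟨w, k, rfl⟩
  · intro i
    by_cases hi : i = j
    · subst hi
      refine ⟨exch B (fun i => Laur.mon (Pi.single i 1)) i * Laur.mon (-Pi.single i 1), ?_⟩
      simp only [List.concat_eq_append, List.nil_append, runX, runB, mutX, Function.update_self,
        map_mul, map_exch]
      congr 1
      exact eq_inv_of_mul_eq_one_right (by rw [univX, ← map_mul, Laur.mon_mul_neg, map_one])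
    · exact ⟨Laur.mon (Pi.single i 1), by simp [runX, mutX, hi, univX]⟩
  simp only [List.concat_eq_append, List.append_assoc, List.singleton_append, List.length_append,
    List.length_cons, List.length_nil] at hd ⊢
  by_cases hjk : j = k
  · subst hjk
    intro i
    rw [runX_append, runX_cons_cons_self hB (subtractionFree_univX I), runB_cons_cons_self]
    exact ih w.length (by omega) hB w rfl i
  -- Reversing all arrows changes no cluster.
  wlog hb : 0 ≤ B j k generalizing B
  · have := this (B := -B) (fun i j => by simp [hB i j]) (by
      simp only [Matrix.neg_apply]; omega)
    intro i
    rw [← runX_neg]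
    exact this i
  have hfr := frameB_skew hB
  refine isLaurent_of_frameB fun w' hw' => ?_
  -- Proper suffixes fall under the induction hypothesis, which ranges over all vertex sets
  -- precisely so that it applies to the framed matrix. In the full word, `inr j` and `inr k` serve
  -- as the generic vertices `e` and `f`.
  rcases eq_or_ne w'.length d with hl | hl
  · have hw : w' = w ++ [k, j] := hw'.eq_of_length (by simp [hl, ← hd])
    rw [hw, List.map_append]
    refine isLaurent_append_of_generic hfr (j := .inl j) (k := .inl k) (e := .inr j) (f := .inr k)
      (by simpa using hjk) hb (by simp [frameB]) (by simp) (by simp) (by simp [frameB, hjk])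
      (by simp [frameB]) _ fun C hC v hv => ?_
    rw [List.length_map] at hv
    exact ih v.length (by omega) hC v rfl
  · have := hw'.length_le
    simp only [List.length_append, List.length_cons, List.length_nil] at this
    exact ih _ (by simp; omega) hfr _ rfl

section Exchange

theorem exch_mem_of_forall {K : Type*} [Field K] {I : Type} [Fintype I] {x : I → K}
    {B : Matrix I I ℤ} {k : I} {S : Type*} [SetLike S K] [SubringClass S K] {F : S} (h : ∀ j, B k j ≠ 0 → x j ∈ F) :
    exch B x k ∈ F := by
  refine add_mem (prod_mem fun j _ => ?_) (prod_mem fun j _ => ?_) <;> by_cases hj : B k j = 0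
  · simp [hj, one_mem]
  · exact pow_mem (h j hj) _
  · simp [hj, one_mem]
  · exact pow_mem (h j hj) _

end Exchange

/-! ### Laurent polynomials in one transcendental element -/

section Field

variable {K : Type*} [Field K] [Algebra ℤ K]

/-- A subring, as a subalgebra for an arbitrary `ℤ`-algebra structure. -/
def intSubalgebra (S : Subring K) : Subalgebra ℤ K :=
  { S with
    algebraMap_mem' := fun r => by
      rw [eq_intCast]
      exact intCast_mem S r }

theorem exists_aeval_eq_mul_pow {R : Subalgebra ℤ K} {a f : K} (ha : a ≠ 0)
    (hf : f ∈ Algebra.adjoin ℤ ((R : Set K) ∪ {a, a⁻¹})) :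
    ∃ (N : ℕ) (p : Polynomial R), a ^ N * f = Polynomial.aeval a p := by
  let S : Subring K := (Polynomial.aeval a : Polynomial R →ₐ[R] K).toRingHom.range
  have haS : a ∈ S := ⟨Polynomial.X, by simp⟩
  have hle : Algebra.adjoin ℤ ((R : Set K) ∪ {a, a⁻¹}) ≤
      intSubalgebra (Laur.clear S a haS) := by
    refine Algebra.adjoin_le ?_
    rintro x (hx | rfl | rfl)
    · exact ⟨0, Polynomial.C ⟨x, hx⟩, by simp⟩
    · exact ⟨0, Polynomial.X, by simp⟩
    · exact ⟨1, 1, by simp [ha]⟩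
  obtain ⟨N, p, hp⟩ := hle hf
  exact ⟨N, p, hp.symm⟩

/-- Laurent polynomials in `a` and in `P / a` are polynomials in `a` and `P / a`. -/
theorem mem_adjoin_of_mem_laurent {R : Subalgebra ℤ K} {a f : K} (ha : Transcendental R a) {P : R}
    (hP : (P : K) ≠ 0) (h1 : f ∈ Algebra.adjoin ℤ ((R : Set K) ∪ {a, a⁻¹}))
    (h2 : f ∈ Algebra.adjoin ℤ ((R : Set K) ∪ {P * a⁻¹, (P * a⁻¹)⁻¹})) :
    f ∈ Algebra.adjoin ℤ ((R : Set K) ∪ {a, P * a⁻¹}) := by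
  have ha0 : a ≠ 0 := by
    rintro rfl
    exact ha isAlgebraic_zero
  have hb0 : (P * a⁻¹ : K)⁻¹ ≠ 0 := by simp [hP, ha0]
  have hab : a = P * (P * a⁻¹ : K)⁻¹ := by field_simp
  obtain ⟨N, p, hp⟩ := exists_aeval_eq_mul_pow ha0 h1
  rw [Set.pair_comm, ← inv_inv (P * a⁻¹ : K), inv_inv (P * a⁻¹ : K)⁻¹] at h2
  obtain ⟨M, q, hq⟩ := exists_aeval_eq_mul_pow hb0 (by simpa using h2)
  set b : K := (P * a⁻¹ : K)⁻¹ with hb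
  obtain ⟨p', hp'⟩ : ∃ p' : Polynomial R, a ^ (N + M) * f = Polynomial.aeval a p' :=
    ⟨Polynomial.X ^ M * p, by simp [← hp]; ring⟩
  obtain ⟨q', hq'⟩ : ∃ q' : Polynomial R, b ^ (N + M) * f = Polynomial.aeval b q' :=
    ⟨Polynomial.X ^ N * q, by simp [← hq]; ring⟩
  generalize N + M = L at hp' hq'
  -- `D` exceeds both degrees and `L`, so multiplying by `P ^ D` clears every power of `P` when `b =
  -- a / P` is written in terms of `a`.
  let D := max (max p'.natDegree q'.natDegree) L + 1
  have hpD : p'.natDegree < D := by omega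
  have hqD : q'.natDegree < D := by omega
  let Q : Polynomial R := ∑ m ∈ Finset.range D, Polynomial.monomial m (P ^ (D - m) * q'.coeff m)
  have hQ : Polynomial.aeval a Q = P ^ D * Polynomial.aeval b q' := by
    rw [Polynomial.aeval_eq_sum_range' hqD, map_sum, Finset.mul_sum]
    refine Finset.sum_congr rfl fun m hm => ?_
    rw [Polynomial.aeval_monomial, Algebra.smul_def, map_mul, map_pow, hab, mul_pow]
    have : (P : K) ^ D = P ^ (D - m) * P ^ m := by
      rw [← pow_add, Nat.sub_add_cancel (Finset.mem_range.1 hm).le]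
    rw [this]
    change (P : K) ^ (D - m) * _ * _ = _
    ring
  have hpoly : Polynomial.C (P ^ D) * p' = Polynomial.C (P ^ L) * Q := by
    rw [transcendental_iff_injective] at ha
    apply ha
    rw [map_mul, map_mul, hQ, ← hp', ← hq', Polynomial.aeval_C, Polynomial.aeval_C, map_pow,
      map_pow]
    change (P : K) ^ D * _ = (P : K) ^ L * _
    rw [hab, mul_pow]
    ring
  have hP0 : P ≠ 0 := fun h => hP (by rw [h]; rfl)
  have hcoeff : ∀ m < D, P ^ D * p'.coeff m = P ^ L * (P ^ (D - m) * q'.coeff m) := by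
    intro m hm
    have := congrArg (fun r => Polynomial.coeff r m) hpoly
    simpa only [Q, Polynomial.coeff_C_mul, Polynomial.finsetSum_coeff, Polynomial.coeff_monomial,
      Finset.sum_ite_eq', Finset.mem_range, hm, if_true] using this
  -- The coefficient of the negative power `a ^ (m - L)` is divisible by `P ^ (L - m)`, exactly what
  -- is needed to rewrite that term through `P / a`.
  have hlow : ∀ m < L, p'.coeff m = P ^ (L - m) * q'.coeff m := by
    intro m hm
    have := hcoeff m (by omega)
    apply mul_left_cancel₀ (pow_ne_zero D hP0)
    rw [this, ← mul_assoc, ← mul_assoc, ← pow_add, ← pow_add]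
    congr 2
    omega
  have hainv : ∀ m, a ^ m * a⁻¹ ^ m = 1 := fun m => by
    rw [← mul_pow, mul_inv_cancel₀ ha0, one_pow]
  have hsum : f = ∑ m ∈ Finset.range D, (p'.coeff m : K) * (a ^ m * (a⁻¹) ^ L) := by
    rw [Polynomial.aeval_eq_sum_range' hpD] at hp'
    apply mul_left_cancel₀ (pow_ne_zero L ha0)
    rw [hp', Finset.mul_sum]
    refine Finset.sum_congr rfl fun m _ => ?_
    rw [Algebra.smul_def]
    change (p'.coeff m : K) * _ = _
    linear_combination -((p'.coeff m : K) * a ^ m) * hainv L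
  have hmem : ∀ r : R, (r : K) ∈ Algebra.adjoin ℤ ((R : Set K) ∪ {a, P * a⁻¹}) := fun r =>
    Algebra.subset_adjoin (Or.inl r.2)
  have hmem₁ : a ∈ Algebra.adjoin ℤ ((R : Set K) ∪ {a, P * a⁻¹}) :=
    Algebra.subset_adjoin (by simp)
  have hmem₂ : P * a⁻¹ ∈ Algebra.adjoin ℤ ((R : Set K) ∪ {a, P * a⁻¹}) :=
    Algebra.subset_adjoin (by simp)
  rw [hsum]
  refine Subalgebra.sum_mem _ fun m _ => ?_
  rcases lt_or_ge m L with hm | hm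
  · have : (p'.coeff m : K) * (a ^ m * (a⁻¹) ^ L) = q'.coeff m * (P * a⁻¹) ^ (L - m) := by
      obtain ⟨d, rfl⟩ := Nat.exists_eq_add_of_lt hm
      rw [hlow m hm]
      push_cast
      rw [show m + d + 1 - m = d + 1 by omega, mul_pow, add_assoc, pow_add a⁻¹ m]
      linear_combination (P : K) ^ (d + 1) * q'.coeff m * a⁻¹ ^ (d + 1) * hainv m
    rw [this]
    exact Subalgebra.mul_mem _ (hmem _) (Subalgebra.pow_mem _ hmem₂ _)
  · have : a ^ m * (a⁻¹) ^ L = a ^ (m - L) := by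
      obtain ⟨d, rfl⟩ := Nat.exists_eq_add_of_le hm
      rw [pow_add, show L + d - L = d by omega]
      linear_combination a ^ d * hainv L
    rw [this]
    exact Subalgebra.mul_mem _ (hmem _) (Subalgebra.pow_mem _ hmem₁ _)

end Field

/-! ### Algebraic independence under mutation -/

section Independent

variable {I : Type} {K : Type*} [Field K] [Algebra ℚ K] {x : I → K}

theorem transcendental_of_algebraicIndependent (hx : AlgebraicIndependent ℚ x) (k : I) :
    Transcendental (IntermediateField.adjoin ℚ (x '' {k}ᶜ)) (x k) :=
  IntermediateField.transcendental_adjoin_iff.2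
    ((AlgebraicIndependent.iff_transcendental_adjoin_image k).1 hx).2

theorem transcendental_subalgebra (hx : AlgebraicIndependent ℚ x) (k : I) [Algebra ℤ K]
    {R : Subalgebra ℤ K}
    (hR : ∀ r ∈ R, r ∈ IntermediateField.adjoin ℚ (x '' {k}ᶜ)) : Transcendental R (x k) := by
  have h := transcendental_of_algebraicIndependent hx k
  rw [transcendental_iff_injective] at h ⊢
  let i : R →+* IntermediateField.adjoin ℚ (x '' {k}ᶜ) :=
    R.val.toRingHom.codRestrict (IntermediateField.adjoin ℚ (x '' {k}ᶜ)).toSubring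
      fun r => hR _ r.2
  have hi : Function.Injective i := fun r s h =>
    Subtype.ext (congrArg (fun z : IntermediateField.adjoin ℚ (x '' {k}ᶜ) => (z : K)) h)
  have : ∀ p : Polynomial R, Polynomial.aeval (x k) p = Polynomial.aeval (x k) (p.map i) := by
    intro p
    rw [Polynomial.aeval_def, Polynomial.aeval_def, Polynomial.eval₂_map]
    rfl
  intro p q hpq
  rw [this, this] at hpq
  exact Polynomial.map_injective i hi (h hpq)

/-- Over the field generated by the other variables, `x k` is algebraic as soon as `c / x k` is. -/
theorem algebraicIndependent_update [DecidableEq I] (hx : AlgebraicIndependent ℚ x) {k : I} {c : K}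
    (hc : c ∈ IntermediateField.adjoin ℚ (x '' {k}ᶜ)) (hc0 : c ≠ 0) :
    AlgebraicIndependent ℚ (Function.update x k (c * (x k)⁻¹)) := by
  have h := transcendental_of_algebraicIndependent hx k
  have hres : (fun j : {j // j ≠ k} => Function.update x k (c * (x k)⁻¹) j) =
      fun j : {j // j ≠ k} => x j := funext fun j => Function.update_of_ne j.2 _ _
  have himg : Function.update x k (c * (x k)⁻¹) '' {k}ᶜ = x '' {k}ᶜ :=
    Set.image_congr fun j hj => Function.update_of_ne hj _ _
  rw [AlgebraicIndependent.iff_transcendental_adjoin_image k, hres, himg,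
    ← IntermediateField.transcendental_adjoin_iff, Function.update_self]
  refine ⟨((AlgebraicIndependent.iff_transcendental_adjoin_image k).1 hx).1, fun hal => h ?_⟩
  have hc' : IsAlgebraic (IntermediateField.adjoin ℚ (x '' {k}ᶜ)) c :=
    isAlgebraic_algebraMap (⟨c, hc⟩ : IntermediateField.adjoin ℚ (x '' {k}ᶜ))
  have : x k = c * (c * (x k)⁻¹)⁻¹ := by rw [mul_inv, inv_inv, mul_inv_cancel_left₀ hc0]
  rw [this]
  exact hc'.mul hal.inv

theorem subtractionFree_of_algebraicIndependent (hx : AlgebraicIndependent ℚ x) :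
    SubtractionFree x := by
  have := SubtractionFree.of_hom (MvPolynomial.eval fun _ => 1)
    (MvPolynomial.aeval x : MvPolynomial I ℚ →ₐ[ℚ] K).toRingHom hx MvPolynomial.X (by simp)
  simpa using this

theorem algebraicIndependent_mutX [DecidableEq I] [Fintype I] (hx : AlgebraicIndependent ℚ x)
    {B : Matrix I I ℤ} {k : I} (hk : B k k = 0) : AlgebraicIndependent ℚ (mutX B x k) :=
  algebraicIndependent_update hx
    (exch_mem_of_forall fun j hj => IntermediateField.subset_adjoin _ _
      ⟨j, fun hjk => hj (by rw [Set.mem_singleton_iff.1 hjk, hk]), rfl⟩)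
    ((subtractionFree_of_algebraicIndependent hx).exch_ne_zero B k)

end Independent

/-! ### Mutation equivalence, freezing and upper cluster algebras -/

namespace Seed

variable {n : ℕ} {s t : Seed n}

theorem arrows_mutate (s : Seed n) (k : Fin n) :
    (s.mutate k).quiver.arrows = mutB s.quiver.arrows k := mutateArrows_eq_mutB _ k

theorem cluster_mutate (s : Seed n) (k : Fin n) :
    (s.mutate k).cluster = mutX s.quiver.arrows s.cluster k := rfl

theorem arrows_self (s : Seed n) (k : Fin n) : s.quiver.arrows k k = 0 := by
  have := s.quiver.skew k k
  omega

theorem mutate_mutate (hs : AlgebraicIndependent ℚ s.cluster) (k : Fin n) :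
    (s.mutate k).mutate k = s := by
  have h := subtractionFree_of_algebraicIndependent hs
  ext i j
  · rw [arrows_mutate, arrows_mutate, mutB_mutB]
  · rfl
  · rw [cluster_mutate, arrows_mutate, cluster_mutate,
      mutX_mutX s.quiver.skew (h.ne_zero k) (h.exch_ne_zero _ k)]

namespace MutEquiv

theorem algebraicIndependent (h : s.MutEquiv t) (hs : AlgebraicIndependent ℚ s.cluster) :
    AlgebraicIndependent ℚ t.cluster := by
  induction h with
  | refl => exact hs
  | tail _ hk ih =>
    obtain ⟨k, -, rfl⟩ := hk
    exact algebraicIndependent_mutX ih (arrows_self _ k)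

theorem symm (h : s.MutEquiv t) (hs : AlgebraicIndependent ℚ s.cluster) : t.MutEquiv s := by
  induction h with
  | refl => exact Relation.ReflTransGen.refl
  | tail h hk ih =>
    obtain ⟨k, hk, rfl⟩ := hk
    exact Relation.ReflTransGen.head
      ⟨k, hk, (mutate_mutate (algebraicIndependent h hs) k).symm⟩ ih

theorem frozen_eq (h : s.MutEquiv t) : t.quiver.frozen = s.quiver.frozen := by
  induction h with
  | refl => rfl
  | tail _ hk ih =>
    obtain ⟨k, -, rfl⟩ := hk
    exact ih

theorem cluster_eq_of_frozen (h : s.MutEquiv t) {i : Fin n} (hi : i ∈ s.quiver.frozen) :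
    t.cluster i = s.cluster i := by
  induction h with
  | refl => rfl
  | tail h hk ih =>
    obtain ⟨k, hk, rfl⟩ := hk
    have hik : i ≠ k := by
      rintro rfl
      exact hk ((frozen_eq h).symm ▸ hi)
    rw [cluster_mutate, mutX, Function.update_of_ne hik, ih]

/-- Freezing only forbids some mutations. Hence the frozen seed has fewer Laurent conditions and
fewer cluster variables, as used in `upperAlgebra_le_freeze` and `clusterAlgebra_freeze_le`. -/
theorem exists_eq_freeze {S : Finset (Fin n)} (h : (s.freeze S).MutEquiv t) :
    ∃ u, s.MutEquiv u ∧ t = u.freeze S := by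
  induction h with
  | refl => exact ⟨s, Relation.ReflTransGen.refl, rfl⟩
  | tail _ hk ih =>
    obtain ⟨k, hk, rfl⟩ := hk
    obtain ⟨u, hu, rfl⟩ := ih
    exact ⟨u.mutate k, hu.tail ⟨k, fun h => hk (Finset.mem_union_left _ h), rfl⟩, rfl⟩

theorem exists_run (h : s.MutEquiv t) : ∃ w : List (Fin n),
    t.quiver.arrows = runB s.quiver.arrows w ∧
      t.cluster = runX s.quiver.arrows s.cluster w := by
  induction h with
  | refl => exact ⟨[], rfl, rfl⟩
  | tail _ hk ih =>
    obtain ⟨k, -, rfl⟩ := hk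
    obtain ⟨w, h1, h2⟩ := ih
    exact ⟨k :: w, by rw [arrows_mutate, h1, runB], by rw [cluster_mutate, h1, h2, runX]⟩

end MutEquiv

/-- The ring of Laurent polynomials in the cluster of a seed. -/
def laurentRing (s : Seed n) : Subalgebra ℤ (RatFunField n) :=
  Algebra.adjoin ℤ (Set.range s.cluster ∪ Set.range fun i => (s.cluster i)⁻¹)

theorem cluster_mem_laurentRing (s : Seed n) (i : Fin n) : s.cluster i ∈ s.laurentRing :=
  Algebra.subset_adjoin (Or.inl ⟨i, rfl⟩)

theorem inv_cluster_mem_laurentRing (s : Seed n) (i : Fin n) :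
    (s.cluster i)⁻¹ ∈ s.laurentRing :=
  Algebra.subset_adjoin (Or.inr ⟨i, rfl⟩)

/-- The upper cluster algebra. -/
def upperAlgebra (s : Seed n) : Subalgebra ℤ (RatFunField n) :=
  ⨅ (t : Seed n) (_ : s.MutEquiv t), t.laurentRing

theorem mem_upperAlgebra {z : RatFunField n} :
    z ∈ s.upperAlgebra ↔ ∀ t, s.MutEquiv t → z ∈ t.laurentRing := by
  simp [upperAlgebra, Algebra.mem_iInf]

/-- The universal Laurent formula is evaluated at the given cluster. -/
theorem MutEquiv.cluster_mem_laurentRing (h : s.MutEquiv t)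
    (hs : AlgebraicIndependent ℚ s.cluster) (i : Fin n) : t.cluster i ∈ s.laurentRing := by
  obtain ⟨w, -, hw⟩ := h.exists_run
  obtain ⟨F, -, hF⟩ := exists_eval_eq_runX (B := s.quiver.arrows) (w := w)
    (fun w' _ => isLaurent s.quiver.skew w') (subtractionFree_of_algebraicIndependent hs) i
  rw [hw, ← hF]
  exact Laur.eval_mem _ _ s.laurentRing.toSubring s.cluster_mem_laurentRing
    s.inv_cluster_mem_laurentRing F

theorem MutEquiv.cluster_mem (h : s.MutEquiv t) (i : Fin n) : t.cluster i ∈ s.clusterAlgebra :=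
  Algebra.subset_adjoin (Or.inl ⟨t, h, i, rfl⟩)

theorem cluster_mem (s : Seed n) (i : Fin n) : s.cluster i ∈ s.clusterAlgebra :=
  MutEquiv.cluster_mem Relation.ReflTransGen.refl i

theorem inv_cluster_mem (s : Seed n) {i : Fin n} (hi : i ∈ s.quiver.frozen) :
    (s.cluster i)⁻¹ ∈ s.clusterAlgebra :=
  Algebra.subset_adjoin (Or.inr ⟨i, hi, rfl⟩)

theorem MutEquiv.clusterAlgebra_le (h : s.MutEquiv t) : t.clusterAlgebra ≤ s.clusterAlgebra := by
  refine Algebra.adjoin_le ?_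
  rintro x (⟨u, hu, i, rfl⟩ | ⟨i, hi, rfl⟩)
  · exact MutEquiv.cluster_mem (h.trans hu) i
  · rw [h.frozen_eq] at hi
    rw [h.cluster_eq_of_frozen hi]
    exact s.inv_cluster_mem hi

theorem MutEquiv.clusterAlgebra_eq (h : s.MutEquiv t) (hs : AlgebraicIndependent ℚ s.cluster) :
    t.clusterAlgebra = s.clusterAlgebra :=
  le_antisymm h.clusterAlgebra_le (h.symm hs).clusterAlgebra_le

theorem clusterAlgebra_le_upperAlgebra (hs : AlgebraicIndependent ℚ s.cluster) :
    s.clusterAlgebra ≤ s.upperAlgebra := by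
  refine Algebra.adjoin_le ?_
  rintro x (⟨u, hu, i, rfl⟩ | ⟨i, hi, rfl⟩) <;> refine mem_upperAlgebra.2 fun t ht => ?_
  · exact MutEquiv.cluster_mem_laurentRing ((ht.symm hs).trans hu) (ht.algebraicIndependent hs) i
  · rw [← ht.cluster_eq_of_frozen hi]
    exact t.inv_cluster_mem_laurentRing i

theorem upperAlgebra_le_freeze (s : Seed n) (S : Finset (Fin n)) :
    s.upperAlgebra ≤ (s.freeze S).upperAlgebra := by
  intro z hz
  refine mem_upperAlgebra.2 fun t ht => ?_
  obtain ⟨u, hu, rfl⟩ := ht.exists_eq_freeze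
  exact mem_upperAlgebra.1 hz u hu

theorem clusterAlgebra_freeze_le (s : Seed n) (S : Finset (Fin n)) :
    (s.freeze S).clusterAlgebra ≤
      Algebra.adjoin ℤ ((s.clusterAlgebra : Set (RatFunField n)) ∪ s.invVariables S) := by
  refine Algebra.adjoin_le ?_
  rintro x (⟨u, hu, i, rfl⟩ | ⟨i, hi, rfl⟩)
  · obtain ⟨v, hv, rfl⟩ := hu.exists_eq_freeze
    exact Algebra.subset_adjoin (Or.inl (hv.cluster_mem i))
  · rcases Finset.mem_union.1 hi with hi | hi
    · exact Algebra.subset_adjoin (Or.inl (s.inv_cluster_mem hi))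
    · exact Algebra.subset_adjoin (Or.inr ⟨i, hi, rfl⟩)

/-- If freezing `S` gives a seed whose upper cluster algebra is its cluster algebra, then it gives
a cluster localization. -/
theorem clusterAlgebra_freeze_eq (hs : AlgebraicIndependent ℚ s.cluster) {S : Finset (Fin n)}
    (h : (s.freeze S).upperAlgebra ≤ (s.freeze S).clusterAlgebra) :
    (s.freeze S).clusterAlgebra =
      Algebra.adjoin ℤ ((s.clusterAlgebra : Set (RatFunField n)) ∪ s.invVariables S) := by
  refine le_antisymm (s.clusterAlgebra_freeze_le S) (Algebra.adjoin_le ?_)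
  rintro x (hx | ⟨i, hi, rfl⟩)
  · exact h (s.upperAlgebra_le_freeze S (clusterAlgebra_le_upperAlgebra hs hx))
  · exact (s.freeze S).inv_cluster_mem (Finset.mem_union_right _ hi)

theorem exists_pow_mul_mem {A : Subalgebra ℤ (RatFunField n)} {S : Finset (Fin n)}
    (hs : AlgebraicIndependent ℚ s.cluster) (hS : ∀ i ∈ S, s.cluster i ∈ A) {z : RatFunField n}
    (hz : z ∈ Algebra.adjoin ℤ ((A : Set (RatFunField n)) ∪ s.invVariables S)) :
    ∃ N : ℕ, (∏ i ∈ S, s.cluster i) ^ N * z ∈ A := by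
  have hmem : ∏ i ∈ S, s.cluster i ∈ A.toSubring := Subalgebra.prod_mem A hS
  have : Algebra.adjoin ℤ ((A : Set (RatFunField n)) ∪ s.invVariables S) ≤
      intSubalgebra (Laur.clear A.toSubring (∏ i ∈ S, s.cluster i) hmem) := by
    refine Algebra.adjoin_le ?_
    rintro x (hx | ⟨i, hi, rfl⟩)
    · exact ⟨0, by simpa using hx⟩
    · refine ⟨1, ?_⟩
      rw [pow_one, ← Finset.prod_erase_mul _ _ hi, mul_inv_cancel_right₀ (hs.ne_zero i)]
      exact Subalgebra.prod_mem A fun j hj => hS j (Finset.mem_of_mem_erase hj)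
  exact this hz

/-! ### Seeds without mutable arrows -/

section Isolated

/-- The cluster variable obtained from a seed by one mutation. -/
def mutVar (s : Seed n) (i : Fin n) : RatFunField n :=
  exch s.quiver.arrows s.cluster i * (s.cluster i)⁻¹

/-- No arrows between mutable vertices. -/
def IsIsolated (s : Seed n) : Prop :=
  ∀ i j, s.quiver.IsMutable i → s.quiver.IsMutable j → s.quiver.arrows i j = 0

/-- Mutation of an isolated seed at a set of mutable vertices. -/
theorem IsIsolated.exists_mutEquiv (hiso : s.IsIsolated) (T : Finset (Fin n))
    (hT : ∀ i ∈ T, s.quiver.IsMutable i) : ∃ t, s.MutEquiv t ∧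
      (∀ i, t.cluster i = if i ∈ T then s.mutVar i else s.cluster i) ∧
      ∀ i, s.quiver.IsMutable i → i ∉ T → t.quiver.arrows i = s.quiver.arrows i := by
  induction T using Finset.induction_on with
  | empty => exact ⟨s, Relation.ReflTransGen.refl, by simp, fun _ _ _ => rfl⟩
  | insert k T hk ih =>
    obtain ⟨t, hst, hc, hrow⟩ := ih fun i hi => hT i (Finset.mem_insert_of_mem hi)
    have hkm := hT k (Finset.mem_insert_self _ _)
    have hkmt : t.quiver.IsMutable k := fun h => hkm (hst.frozen_eq ▸ h)
    have hx : exch s.quiver.arrows t.cluster k = exch s.quiver.arrows s.cluster k := by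
      have hj : ∀ j, s.quiver.arrows k j ≠ 0 → t.cluster j = s.cluster j := by
        intro j hj
        rw [hc, if_neg]
        exact fun hjT => hj (hiso k j hkm (hT j (Finset.mem_insert_of_mem hjT)))
      unfold exch
      congr 1 <;> refine Finset.prod_congr rfl fun j _ => ?_ <;>
        by_cases h0 : s.quiver.arrows k j = 0
      · simp [h0]
      · rw [hj j h0]
      · simp [h0]
      · rw [hj j h0]
    refine ⟨t.mutate k, hst.tail ⟨k, hkmt, rfl⟩, fun i => ?_, fun i him hi => ?_⟩
    · rw [cluster_mutate]
      by_cases hik : i = k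
      · subst hik
        rw [mutX, Function.update_self, if_pos (Finset.mem_insert_self _ _), mutVar, hc i,
          if_neg hk, ← hx]
        simp only [exch, hrow i hkm hk]
      · simp [mutX, Finset.mem_insert, hik, hc]
    · rw [Finset.mem_insert, not_or] at hi
      rw [← hrow i him hi.2, arrows_mutate]
      have hik : t.quiver.arrows i k = 0 := by rw [hrow i him hi.2, hiso i k him hkm]
      funext j
      by_cases hj : k = j
      · subst hj; simp [mutB, hik]
      · simp [mutB, hik, hj, Ne.symm hi.1]

/-- Generators at the vertex `l`: the variable and its mutation for `l ∈ J`, otherwise one of the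
two and its inverse, depending on `l ∈ T`. -/
def mixedGens (s : Seed n) (J T : Finset (Fin n)) (l : Fin n) : Set (RatFunField n) :=
  if l ∈ J then {s.cluster l, s.mutVar l}
  else if l ∈ T then {s.mutVar l, (s.mutVar l)⁻¹} else {s.cluster l, (s.cluster l)⁻¹}

theorem mutate_cluster_self (s : Seed n) (i : Fin n) : (s.mutate i).cluster i = s.mutVar i := by
  rw [cluster_mutate, mutX, Function.update_self, mutVar]

theorem mutVar_mem (s : Seed n) {i : Fin n} (hi : s.quiver.IsMutable i) :
    s.mutVar i ∈ s.clusterAlgebra := by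
  rw [← mutate_cluster_self]
  exact MutEquiv.cluster_mem (Relation.ReflTransGen.single ⟨i, hi, rfl⟩) i

/-- Induction on `J` trades, one vertex at a time, the two Laurent conditions in `x` and in its
mutation `P / x` for polynomiality in both. `T` stays arbitrary so that both conditions are
available at the next vertex. -/
theorem IsIsolated.upperAlgebra_le_mixed (hs : AlgebraicIndependent ℚ s.cluster)
    (hiso : s.IsIsolated) (J T : Finset (Fin n)) (hJ : ∀ i ∈ J, s.quiver.IsMutable i)
    (hT : ∀ i ∈ T, s.quiver.IsMutable i) (hJT : Disjoint J T) :
    s.upperAlgebra ≤ Algebra.adjoin ℤ (⋃ l, s.mixedGens J T l) := by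
  induction J using Finset.induction_on generalizing T with
  | empty =>
    obtain ⟨t, hst, hc, -⟩ := hiso.exists_mutEquiv T hT
    intro z hz
    refine Algebra.adjoin_mono ?_ (mem_upperAlgebra.1 hz t hst)
    rintro _ (⟨i, rfl⟩ | ⟨i, rfl⟩) <;> refine Set.mem_iUnion.2 ⟨i, ?_⟩ <;>
      by_cases hi : i ∈ T <;> simp [mixedGens, hc, hi]
  | insert i J hi ih =>
    have hJ' : ∀ i ∈ J, s.quiver.IsMutable i := fun j hj => hJ j (Finset.mem_insert_of_mem hj)
    have him := hJ i (Finset.mem_insert_self _ _)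
    rw [Finset.disjoint_insert_left] at hJT
    -- The hypothesis for `T` inverts the variable at `i`, and the one for `insert i T` inverts its
    -- mutation; the generators at all other vertices, which span `R`, agree.
    intro z hz
    have h1 := ih T hJ' hT hJT.2 hz
    have h2 := ih (insert i T) hJ' (by
      intro j hj
      rcases Finset.mem_insert.1 hj with rfl | hj
      exacts [him, hT j hj]) (Finset.disjoint_insert_right.2 ⟨hi, hJT.2⟩) hz
    set R : Subalgebra ℤ (RatFunField n) :=
      Algebra.adjoin ℤ (⋃ (l : Fin n) (_ : l ≠ i), s.mixedGens J T l) with hR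
    have hsub : ∀ l, l ≠ i → s.mixedGens J T l ⊆ R := fun l hl x hx =>
      Algebra.subset_adjoin (Set.mem_iUnion₂.2 ⟨l, hl, hx⟩)
    have hPR : exch s.quiver.arrows s.cluster i ∈ R := by
      refine exch_mem_of_forall fun j hj => ?_
      have hjm : ¬ s.quiver.IsMutable j := fun hjm => hj (hiso i j him hjm)
      refine hsub j (fun h => hjm (h ▸ him)) ?_
      rw [mixedGens, if_neg fun h => hjm (hJ' j h), if_neg fun h => hjm (hT j h)]
      exact Or.inl rfl
    -- No mutable vertex has an arrow to or from `i`, so the generators of `R` do not involve the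
    -- variable at `i`.
    have htr : Transcendental R (s.cluster i) := by
      refine transcendental_subalgebra hs i fun r hr => ?_
      have hx : ∀ l, l ≠ i → s.cluster l ∈
          IntermediateField.adjoin ℚ (s.cluster '' {i}ᶜ) := fun l hl =>
        IntermediateField.subset_adjoin _ _ ⟨l, hl, rfl⟩
      have hy : ∀ l, l ≠ i → s.quiver.IsMutable l → s.mutVar l ∈
          IntermediateField.adjoin ℚ (s.cluster '' {i}ᶜ) := fun l hl hlm =>
        mul_mem (exch_mem_of_forall fun j hj => hx j (by
          rintro rfl
          exact hj (hiso l j hlm him))) (inv_mem (hx l hl))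
      have hinv : ∀ z ∈ IntermediateField.adjoin ℚ (s.cluster '' {i}ᶜ),
          z⁻¹ ∈ IntermediateField.adjoin ℚ (s.cluster '' {i}ᶜ) := fun z hz => inv_mem hz
      have hle : R ≤ intSubalgebra (IntermediateField.adjoin ℚ (s.cluster '' {i}ᶜ)).toSubring := by
        refine Algebra.adjoin_le (Set.iUnion₂_subset fun l hl => ?_)
        rw [mixedGens]
        split_ifs with hlJ hlT
        · rintro _ (rfl | rfl)
          exacts [hx l hl, hy l hl (hJ' l hlJ)]
        · rintro _ (rfl | rfl)
          exacts [hy l hl (hT l hlT), hinv _ (hy l hl (hT l hlT))]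
        · rintro _ (rfl | rfl)
          exacts [hx l hl, hinv _ (hx l hl)]
      exact hle hr
    have hadj : ∀ (J' T' : Finset (Fin n)), (∀ l, l ≠ i → s.mixedGens J' T' l = s.mixedGens J T l) →
        Algebra.adjoin ℤ (⋃ l, s.mixedGens J' T' l) =
          Algebra.adjoin ℤ ((R : Set (RatFunField n)) ∪ s.mixedGens J' T' i) := by
      intro J' T' h
      refine le_antisymm (Algebra.adjoin_le (Set.iUnion_subset fun l => ?_))
        (Algebra.adjoin_le (Set.union_subset ?_ ?_))
      · by_cases hl : l = i
        · subst hl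
          exact fun x hx => Algebra.subset_adjoin (Or.inr hx)
        · rw [h l hl]
          exact fun x hx => Algebra.subset_adjoin (Or.inl (hsub l hl hx))
      · refine SetLike.coe_subset_coe.2 (Algebra.adjoin_le (Set.iUnion₂_subset fun l hl => ?_))
        rw [← h l hl]
        exact fun x hx => Algebra.subset_adjoin (Set.mem_iUnion.2 ⟨l, hx⟩)
      · exact fun x hx => Algebra.subset_adjoin (Set.mem_iUnion.2 ⟨i, hx⟩)
    rw [hadj J T fun _ _ => rfl, mixedGens, if_neg hi, if_neg hJT.1] at h1
    rw [hadj J (insert i T) fun l hl => by simp [mixedGens, hl], mixedGens, if_neg hi,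
      if_pos (Finset.mem_insert_self _ _)] at h2
    rw [hadj (insert i J) T fun l hl => by simp [mixedGens, hl], mixedGens,
      if_pos (Finset.mem_insert_self _ _)]
    exact mem_adjoin_of_mem_laurent htr (P := ⟨_, hPR⟩)
      ((subtractionFree_of_algebraicIndependent hs).exch_ne_zero _ i) h1 h2

theorem IsIsolated.upperAlgebra_le (hs : AlgebraicIndependent ℚ s.cluster) (hiso : s.IsIsolated) :
    s.upperAlgebra ≤ s.clusterAlgebra := by
  have hmem : ∀ l, l ∈ s.quiver.frozenᶜ ↔ s.quiver.IsMutable l := fun l => Finset.mem_compl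
  refine (hiso.upperAlgebra_le_mixed hs s.quiver.frozenᶜ ∅ (fun i hi => (hmem i).1 hi)
    (by simp) (by simp)).trans (Algebra.adjoin_le (Set.iUnion_subset fun l => ?_))
  rw [mixedGens]
  split_ifs with hl hl'
  · rintro _ (rfl | rfl)
    exacts [s.cluster_mem l, s.mutVar_mem ((hmem l).1 hl)]
  · simp at hl'
  · rintro _ (rfl | rfl)
    · exact s.cluster_mem l
    · exact s.inv_cluster_mem (by simpa using hl)

end Isolated

end Seed

/-! ### Covering pairs, and acyclic seeds have equal cluster and upper cluster algebras -/

theorem IceQuiver.IsAcyclic.not_isBiinfinitePath {n : ℕ} {Q : IceQuiver n} (hQ : Q.IsAcyclic)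
    (p : ℤ → Fin n) : ¬ Q.IsBiinfinitePath p := by
  intro hp
  have htrans : ∀ (a : ℤ) (m : ℕ), Relation.TransGen Q.MutArrow (p a) (p (a + (m + 1 : ℕ))) := by
    intro a m
    induction m with
    | zero => simpa using Relation.TransGen.single (hp a)
    | succ m ih =>
      refine ih.tail ?_
      convert hp (a + (m + 1 : ℕ)) using 2
      push_cast; ring
  -- There are finitely many vertices, so the path revisits one and closes up to a cycle.
  obtain ⟨a, b, hab, h⟩ := Finite.exists_ne_map_eq_of_infinite fun m : ℕ => p m
  wlog hlt : a < b generalizing a b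
  · exact this b a hab.symm h.symm (lt_of_le_of_ne (not_lt.1 hlt) hab.symm)
  obtain ⟨d, rfl⟩ := Nat.exists_eq_add_of_lt hlt
  have := htrans a d
  rw [show ((a : ℤ) + (d + 1 : ℕ)) = ((a + d + 1 : ℕ) : ℤ) by push_cast; ring, ← h] at this
  exact hQ _ this

/-- An edge in a set of edges in which every edge has a successor and a predecessor lies on a
bi-infinite path. -/
theorem exists_biinfinite {V : Type*} {r : V → V → Prop}
    (hnext : ∀ u v, r u v → ∃ w, r v w) (hprev : ∀ u v, r u v → ∃ w, r w u) {i j : V}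
    (hij : r i j) : ∃ p : ℤ → V, (∀ k, r (p k) (p (k + 1))) ∧ p 1 = i ∧ p 2 = j := by
  let E := {e : V × V // r e.1 e.2}
  choose nx hnx using hnext
  choose pv hpv using hprev
  let next : E → E := fun e => ⟨(e.1.2, nx _ _ e.2), hnx _ _ e.2⟩
  let prev : E → E := fun e => ⟨(pv _ _ e.2, e.1.1), hpv _ _ e.2⟩
  let e₀ : E := ⟨(i, j), hij⟩
  -- `f k` is the `k`-th edge of the path; the given edge sits at index `1`, whence the shifts.
  let f : ℤ → E := fun k => if 1 ≤ k then next^[(k - 1).toNat] e₀ else prev^[(1 - k).toNat] e₀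
  have hf : ∀ k, (f k).1.2 = (f (k + 1)).1.1 := by
    intro k
    by_cases hk : 1 ≤ k
    · simp only [f, hk, if_true, show 1 ≤ k + 1 by omega]
      rw [show (k + 1 - 1).toNat = (k - 1).toNat + 1 by omega, Function.iterate_succ_apply']
    · have hk1 : f (k + 1) = prev^[(-k).toNat] e₀ := by
        simp only [f]
        split_ifs with h
        · obtain rfl : k = 0 := by omega
          rfl
        · congr 2; omega
      rw [hk1]
      simp only [f, hk, if_false]
      rw [show (1 - k).toNat = (-k).toNat + 1 by omega, Function.iterate_succ_apply']
  refine ⟨fun k => (f k).1.1, fun k => ?_, by simp [f, e₀], ?_⟩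
  · change r (f k).1.1 (f (k + 1)).1.1
    rw [← hf]
    exact (f k).2
  · have := hf 1
    simpa [f, e₀] using this.symm

namespace Seed

variable {n : ℕ} {s t : Seed n}

/-- The exchange relation, evaluated in a field where the variable at `v` vanishes. -/
theorem sum_prod_eq_zero (hs : AlgebraicIndependent ℚ s.cluster) {k : Type*} [Field k]
    (χ : s.clusterAlgebra →+* k) {v : Fin n} (hv : s.quiver.IsMutable v)
    (h0 : χ ⟨s.cluster v, s.cluster_mem v⟩ = 0) :
    ∏ j, χ ⟨s.cluster j, s.cluster_mem j⟩ ^ (s.quiver.arrows v j).toNat +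
      ∏ j, χ ⟨s.cluster j, s.cluster_mem j⟩ ^ (-s.quiver.arrows v j).toNat = 0 := by
  let α : Fin n → s.clusterAlgebra := fun j => ⟨s.cluster j, s.cluster_mem j⟩
  have h : (⟨s.mutVar v, s.mutVar_mem hv⟩ : s.clusterAlgebra) * α v = exch s.quiver.arrows α v := by
    apply Subtype.ext
    have := map_exch s.clusterAlgebra.val.toRingHom s.quiver.arrows α v
    refine Eq.trans ?_ this.symm
    exact inv_mul_cancel_right₀ (hs.ne_zero v) _
  have h' := congrArg χ h
  rw [map_mul, h0, mul_zero, map_exch] at h'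
  exact h'.symm

/-- The two variables of a covering pair have no common zero. -/
theorem not_both_zero_of_isCoveringPair (hs : AlgebraicIndependent ℚ s.cluster) {i j : Fin n}
    (hij : s.quiver.IsCoveringPair i j) {k : Type*} [Field k] (χ : s.clusterAlgebra →+* k) :
    χ ⟨s.cluster i, s.cluster_mem i⟩ ≠ 0 ∨ χ ⟨s.cluster j, s.cluster_mem j⟩ ≠ 0 := by
  by_contra hcon
  push Not at hcon
  obtain ⟨harr, hno⟩ := hij
  let a : Fin n → k := fun j => χ ⟨s.cluster j, s.cluster_mem j⟩
  have hmut : ∀ v, a v = 0 → s.quiver.IsMutable v := by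
    intro v hv hfr
    have h1 : (⟨s.cluster v, s.cluster_mem v⟩ : s.clusterAlgebra) *
        ⟨_, s.inv_cluster_mem hfr⟩ = 1 := Subtype.ext (mul_inv_cancel₀ (hs.ne_zero v))
    have h2 := congrArg χ h1
    rw [map_mul, map_one] at h2
    change a v * _ = 1 at h2
    rw [hv, zero_mul] at h2
    exact zero_ne_one h2
  have hzero : ∀ (m : Fin n → ℕ), (∏ j, a j ^ m j = 0) ↔ ∃ j, a j = 0 ∧ 0 < m j := by
    intro m
    simp [Finset.prod_eq_zero_iff, Nat.pos_iff_ne_zero]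
  -- Two field elements with sum `0` vanish together, and a product vanishes iff one of its factors
  -- does.
  have key : ∀ v, a v = 0 → ((∃ w, a w = 0 ∧ 0 < s.quiver.arrows v w) ↔
      ∃ w, a w = 0 ∧ 0 < s.quiver.arrows w v) := by
    intro v hv
    have h := sum_prod_eq_zero hs χ (hmut v hv) hv
    have h1 := hzero fun j => (s.quiver.arrows v j).toNat
    have h2 := hzero fun j => (-s.quiver.arrows v j).toNat
    have h3 : (∏ j, a j ^ (s.quiver.arrows v j).toNat = 0) ↔
        ∏ j, a j ^ (-s.quiver.arrows v j).toNat = 0 := by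
      constructor <;> intro h4
      · simpa [a, h4] using h
      · simpa [a, h4] using h
    have h4 : ∀ w, -s.quiver.arrows v w = s.quiver.arrows w v := fun w => (s.quiver.skew v w).symm
    simp only [h4] at h2 h3
    simp only [Int.pos_iff_toNat_pos]
    rw [← h1, ← h2, h3]
  obtain ⟨p, hp, h1, h2⟩ := exists_biinfinite
    (r := fun u v => a u = 0 ∧ a v = 0 ∧ 0 < s.quiver.arrows u v)
    (fun u v ⟨hu, hv, huv⟩ => by
      obtain ⟨w, hw, hvw⟩ := (key v hv).2 ⟨u, hu, huv⟩
      exact ⟨w, hv, hw, hvw⟩)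
    (fun u v ⟨hu, hv, huv⟩ => by
      obtain ⟨w, hw, hwu⟩ := (key u hu).1 ⟨v, hv, huv⟩
      exact ⟨w, hw, hu, hwu⟩)
    ⟨hcon.1, hcon.2, harr.2.2⟩
  exact hno ⟨p, fun k => ⟨hmut _ (hp k).1, hmut _ (hp k).2.1, (hp k).2.2⟩, h1, h2⟩

theorem IsAcyclic.freeze (h : s.IsAcyclic) (S : Finset (Fin n)) : (s.freeze S).IsAcyclic := by
  intro i hi
  refine h i (Relation.TransGen.mono (fun u v huv => ?_) _ _ hi)
  obtain ⟨hu, hv, huv⟩ := huv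
  exact ⟨fun h => hu (Finset.mem_union_left _ h), fun h => hv (Finset.mem_union_left _ h), huv⟩

theorem exists_pow_mul_mem_of_freeze (hs : AlgebraicIndependent ℚ s.cluster) (i : Fin n)
    {z : RatFunField n} (hz : z ∈ (s.freeze {i}).clusterAlgebra) :
    ∃ N : ℕ, s.cluster i ^ N * z ∈ s.clusterAlgebra := by
  have := exists_pow_mul_mem (A := s.clusterAlgebra) hs (fun j _ => s.cluster_mem j)
    (s.clusterAlgebra_freeze_le {i} hz)
  simpa using this

/-- The cluster algebra of an acyclic seed is its upper cluster algebra. -/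
theorem IsAcyclic.upperAlgebra_le (hs : AlgebraicIndependent ℚ s.cluster) (h : s.IsAcyclic) :
    s.upperAlgebra ≤ s.clusterAlgebra := by
  induction hm : (s.quiver.frozenᶜ).card using Nat.strong_induction_on generalizing s with
  | _ m ih =>
  by_cases hiso : s.IsIsolated
  · exact hiso.upperAlgebra_le hs
  obtain ⟨i, j, hi, hj, hij⟩ : ∃ i j, s.quiver.IsMutable i ∧ s.quiver.IsMutable j ∧
      0 < s.quiver.arrows i j := by
    simp only [IsIsolated, not_forall] at hiso
    obtain ⟨i, j, hi, hj, hij⟩ := hiso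
    rcases lt_or_gt_of_ne hij with hlt | hgt
    · exact ⟨j, i, hj, hi, by rw [s.quiver.skew i j]; omega⟩
    · exact ⟨i, j, hi, hj, hgt⟩
  have hcov : s.quiver.IsCoveringPair i j :=
    ⟨⟨hi, hj, hij⟩, fun ⟨p, hp, _⟩ => IceQuiver.IsAcyclic.not_isBiinfinitePath h p hp⟩
  have hfr : ∀ v, s.quiver.IsMutable v → (s.freeze {v}).upperAlgebra ≤
      (s.freeze {v}).clusterAlgebra := by
    intro v hv
    refine ih _ ?_ (s := s.freeze {v}) hs (h.freeze {v}) rfl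
    rw [← hm]
    refine Finset.card_lt_card (Finset.compl_ssubset_compl.2 ?_)
    refine Finset.ssubset_iff_of_subset Finset.subset_union_left |>.2 ⟨v, ?_, hv⟩
    exact Finset.mem_union_right _ (Finset.mem_singleton_self v)
  intro z hz
  obtain ⟨N, hN⟩ := exists_pow_mul_mem_of_freeze hs i
    (hfr i hi (s.upperAlgebra_le_freeze {i} hz))
  obtain ⟨M, hM⟩ := exists_pow_mul_mem_of_freeze hs j
    (hfr j hj (s.upperAlgebra_le_freeze {j} hz))
  let a : s.clusterAlgebra := ⟨s.cluster i, s.cluster_mem i⟩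
  let b : s.clusterAlgebra := ⟨s.cluster j, s.cluster_mem j⟩
  -- A maximal ideal containing both variables would give a common zero in its residue field.
  have hcop : IsCoprime a b := by
    rw [← Ideal.isCoprime_span_singleton_iff, Ideal.isCoprime_iff_sup_eq]
    by_contra hne
    obtain ⟨I, hI, hle⟩ := Ideal.exists_le_maximal _ hne
    let _ := Ideal.Quotient.field I
    have ha : Ideal.Quotient.mk I a = 0 := Ideal.Quotient.eq_zero_iff_mem.2
      (hle (Ideal.mem_sup_left (Ideal.mem_span_singleton_self a)))
    have hb : Ideal.Quotient.mk I b = 0 := Ideal.Quotient.eq_zero_iff_mem.2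
      (hle (Ideal.mem_sup_right (Ideal.mem_span_singleton_self b)))
    rcases not_both_zero_of_isCoveringPair hs hcov (Ideal.Quotient.mk I) with h | h
    exacts [h ha, h hb]
  obtain ⟨c, d, hcd⟩ := (hcop.pow (m := N) (n := M))
  have hz' : z = c * (s.cluster i ^ N * z) + d * (s.cluster j ^ M * z) := by
    have : (c : RatFunField n) * s.cluster i ^ N + d * s.cluster j ^ M = 1 :=
      congrArg Subtype.val hcd
    linear_combination -z * this
  rw [hz']
  exact Subalgebra.add_mem _ (Subalgebra.mul_mem _ c.2 hN) (Subalgebra.mul_mem _ d.2 hM)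

end Seed

/-! ### Localizations inside a field and the covering by charts -/

theorem isLocalization_away_inclusion {K : Type*} [Field K] [Algebra ℤ K] {A A' : Subalgebra ℤ K}
    (h : A ≤ A') (f : A) (hf : (f : K) ≠ 0) (hinv : (f : K)⁻¹ ∈ A')
    (hpow : ∀ z ∈ A', ∃ N : ℕ, (f : K) ^ N * z ∈ A) :
    letI := (Subalgebra.inclusion h).toRingHom.toAlgebra
    IsLocalization.Away f A' := by
  let _ := (Subalgebra.inclusion h).toRingHom.toAlgebra
  have hcoe : ∀ x : A, ((algebraMap A A' x : A') : K) = x := fun _ => rfl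
  refine ⟨?_, ?_, ?_⟩
  · rintro ⟨_, N, rfl⟩
    rw [map_pow]
    refine IsUnit.pow N (IsUnit.of_mul_eq_one ⟨_, hinv⟩ (Subtype.ext ?_))
    exact mul_inv_cancel₀ hf
  · intro z
    obtain ⟨N, hN⟩ := hpow z z.2
    refine ⟨⟨⟨_, hN⟩, ⟨f ^ N, N, rfl⟩⟩, Subtype.ext ?_⟩
    simp only [map_pow, Subalgebra.coe_mul, Subalgebra.coe_pow, hcoe]
    exact mul_comm _ _
  · intro x y hxy
    refine ⟨1, ?_⟩
    have : x = y := Subtype.ext (congrArg (fun w : A' => (w : K)) hxy : (x : K) = y)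
    rw [this]

/-- Extending a hom to a field, from `A` to a subring of a localization of `A`. -/
theorem exists_extension {K : Type*} [Field K] [Algebra ℤ K] {A B : Subalgebra ℤ K} {f : K}
    (hf : f ∈ A) (hf0 : f ≠ 0) (hpow : ∀ z ∈ B, ∃ N : ℕ, f ^ N * z ∈ A) {k : Type*} [Field k]
    (χ : A →+* k) (hχ : χ ⟨f, hf⟩ ≠ 0) :
    ∃ χ' : B →+* k, ∀ z (hA : z ∈ A) (hB : z ∈ B), χ' ⟨z, hB⟩ = χ ⟨z, hA⟩ := by
  -- `C` is `A[1/f]`. `B` lies in it but need not contain `A`, so `χ` is extended to `C` and then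
  -- restricted to `B`.
  let C : Subalgebra ℤ K := intSubalgebra (Laur.clear A.toSubring f hf)
  have hAC : A ≤ C := fun z hz => ⟨0, by simpa using hz⟩
  have hBC : B ≤ C := hpow
  let _ := (Subalgebra.inclusion hAC).toRingHom.toAlgebra
  have hloc : IsLocalization.Away (⟨f, hf⟩ : A) C :=
    isLocalization_away_inclusion hAC ⟨f, hf⟩ hf0 ⟨1, by simp [hf0]⟩
      fun z hz => hz
  refine ⟨(IsLocalization.Away.lift (S := C) (⟨f, hf⟩ : A) (isUnit_iff_ne_zero.2 hχ)).comp
    (Subalgebra.inclusion hBC).toRingHom, fun z hA hB => ?_⟩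
  exact IsLocalization.Away.lift_eq (S := C) (⟨f, hf⟩ : A) (isUnit_iff_ne_zero.2 hχ) ⟨z, hA⟩

namespace Seed

variable {n : ℕ} {s t : Seed n}

/-- `t` is a freezing of a seed of `𝒜(s)`, at a set of vertices where the cluster variables do not
vanish under `χ`. -/
def ChartContains {k : Type} [Field k] {s : Seed n} (χ : s.clusterAlgebra →+* k) (t : Seed n) :
    Prop :=
  ∃ (u : Seed n) (S : Finset (Fin n)) (hu : s.MutEquiv u), (∀ i ∈ S, u.quiver.IsMutable i) ∧
    t = u.freeze S ∧ ∀ i ∈ S, χ ⟨u.cluster i, hu.cluster_mem i⟩ ≠ 0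

theorem freeze_freeze (s : Seed n) (S T : Finset (Fin n)) :
    (s.freeze S).freeze T = s.freeze (S ∪ T) := by
  simp [freeze, IceQuiver.freeze, Finset.union_assoc]

namespace BanffOutput

theorem finite {O : Set (Seed n)} (h : s.BanffOutput O) : O.Finite := by
  induction h with
  | halt => exact Set.finite_singleton _
  | branch _ _ _ _ _ _ _ _ _ _ _ ih₁ ih₂ => exact ih₁.union ih₂

theorem isAcyclic {O : Set (Seed n)} (h : s.BanffOutput O) : ∀ t ∈ O, t.IsAcyclic := by
  induction h with
  | halt s t _ ht => rintro _ rfl; exact ht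
  | branch _ _ _ _ _ _ _ _ _ _ _ ih₁ ih₂ =>
    rintro t (ht | ht)
    exacts [ih₁ t ht, ih₂ t ht]

/-- Merges nested freezings into one: mutations made after freezing `i` never touch `i`, so they can
be performed before it, and the variable at `i` is unchanged. -/
theorem exists_eq_freeze_of_freeze {s' : Seed n} {i : Fin n} (hs' : s.MutEquiv s')
    (hi : s'.quiver.IsMutable i) {u₁ : Seed n} {S : Finset (Fin n)}
    (hu : (s'.freeze {i}).MutEquiv u₁) (hS : ∀ j ∈ S, u₁.quiver.IsMutable j) :
    ∃ u, s.MutEquiv u ∧ (∀ j ∈ {i} ∪ S, u.quiver.IsMutable j) ∧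
      u₁.freeze S = u.freeze ({i} ∪ S) ∧ u.cluster = u₁.cluster ∧ u.cluster i = s'.cluster i := by
  have hc := hu.cluster_eq_of_frozen (i := i)
    (Finset.mem_union_right _ (Finset.mem_singleton_self i))
  obtain ⟨u, hu', rfl⟩ := hu.exists_eq_freeze
  refine ⟨u, hs'.trans hu', fun j hj => ?_, freeze_freeze _ _ _, rfl, hc⟩
  rcases Finset.mem_union.1 hj with hj | hj
  · rw [Finset.mem_singleton.1 hj, IceQuiver.IsMutable, hu'.frozen_eq]
    exact hi
  · exact fun h => hS j hj (Finset.mem_union_left _ h)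

theorem exists_eq_freeze {O : Set (Seed n)} (h : s.BanffOutput O) : ∀ t ∈ O,
    ∃ (u : Seed n) (S : Finset (Fin n)), s.MutEquiv u ∧ (∀ i ∈ S, u.quiver.IsMutable i) ∧
      t = u.freeze S := by
  have step : ∀ {s s' t : Seed n} {i : Fin n}, s.MutEquiv s' → s'.quiver.IsMutable i →
      (∃ (u : Seed n) (S : Finset (Fin n)), (s'.freeze {i}).MutEquiv u ∧
        (∀ i ∈ S, u.quiver.IsMutable i) ∧ t = u.freeze S) →
      ∃ (u : Seed n) (S : Finset (Fin n)), s.MutEquiv u ∧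
        (∀ i ∈ S, u.quiver.IsMutable i) ∧ t = u.freeze S := by
    rintro s s' t i hs' hi ⟨u₁, S, hu, hS, rfl⟩
    obtain ⟨u, h1, h2, h3, -⟩ := exists_eq_freeze_of_freeze hs' hi hu hS
    exact ⟨u, _, h1, h2, h3⟩
  induction h with
  | halt s t hst =>
    intro u hu
    refine ⟨t, ∅, hst, by simp, ?_⟩
    rw [Set.mem_singleton_iff.1 hu]
    simp [freeze, IceQuiver.freeze]
  | branch s s' i₁ i₂ O₁ O₂ _ hs' hcov _ _ ih₁ ih₂ =>
    rintro t (ht | ht)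
    exacts [step hs' hcov.1.1 (ih₁ t ht), step hs' hcov.1.2.1 (ih₂ t ht)]

theorem exists_chartContains {O : Set (Seed n)} (h : s.BanffOutput O)
    (hs : AlgebraicIndependent ℚ s.cluster) {k : Type} [Field k] (χ : s.clusterAlgebra →+* k) :
    ∃ t ∈ O, ChartContains χ t := by
  have step : ∀ {s s' : Seed n} {O : Set (Seed n)} {i : Fin n} (hs' : s.MutEquiv s'),
      AlgebraicIndependent ℚ s.cluster → s'.quiver.IsMutable i →
      (∀ χ' : (s'.freeze {i}).clusterAlgebra →+* k, ∃ t ∈ O, ChartContains χ' t) →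
      ∀ χ : s.clusterAlgebra →+* k, χ ⟨s'.cluster i, hs'.cluster_mem i⟩ ≠ 0 →
      ∃ t ∈ O, ChartContains χ t := by
    intro s s' O i hs' hs hi ih χ hχ
    have hs'' := hs'.algebraicIndependent hs
    obtain ⟨χ', hχ'⟩ := exists_extension (B := (s'.freeze {i}).clusterAlgebra)
      (hs'.cluster_mem i) (hs''.ne_zero i) (fun z hz => by
        rw [← hs'.clusterAlgebra_eq hs]
        exact exists_pow_mul_mem_of_freeze hs'' i hz) χ hχ
    -- The extension agrees with `χ` on elements common to both algebras, in particular on the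
    -- variables of the chart, so nonvanishing transfers back to `χ`.
    obtain ⟨_, ht, u₁, S, hu, hS, rfl, hne⟩ := ih χ'
    obtain ⟨u, h1, h2, h3, h4, h5⟩ := exists_eq_freeze_of_freeze hs' hi hu hS
    refine ⟨_, ht, u, _, h1, h2, h3, fun j hj => ?_⟩
    rcases Finset.mem_union.1 hj with hj | hj
    · obtain rfl := Finset.mem_singleton.1 hj
      simpa only [h5] using hχ
    · have := hne j hj
      rw [hχ' _ (by rw [← h4]; exact h1.cluster_mem j)] at this
      simpa only [h4] using this
  induction h with
  | halt s t hst =>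
    exact ⟨t, rfl, t, ∅, hst, by simp, by simp [freeze, IceQuiver.freeze], by simp⟩
  | branch s s' i₁ i₂ O₁ O₂ _ hs' hcov _ _ ih₁ ih₂ =>
    have hs'' := hs'.algebraicIndependent hs
    rcases not_both_zero_of_isCoveringPair hs'' hcov
      (χ.comp (Subalgebra.inclusion hs'.clusterAlgebra_le).toRingHom) with hne | hne
    · obtain ⟨t, ht, h⟩ := step hs' hs hcov.1.1 (ih₁ hs'') χ hne
      exact ⟨t, Or.inl ht, h⟩
    · obtain ⟨t, ht, h⟩ := step hs' hs hcov.1.2.1 (ih₂ hs'') χ hne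
      exact ⟨t, Or.inr ht, h⟩

end BanffOutput

section Chart

variable {u : Seed n} {S : Finset (Fin n)}

/-- Acyclicity of the frozen seed alone suffices; nothing is assumed about the intermediate
freezings. -/
theorem MutEquiv.clusterAlgebra_freeze_eq (hs : AlgebraicIndependent ℚ s.cluster)
    (hu : s.MutEquiv u) (hac : (u.freeze S).IsAcyclic) : (u.freeze S).clusterAlgebra =
      Algebra.adjoin ℤ ((s.clusterAlgebra : Set (RatFunField n)) ∪ u.invVariables S) := by
  have hu' := hu.algebraicIndependent hs
  rw [← hu.clusterAlgebra_eq hs]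
  exact Seed.clusterAlgebra_freeze_eq hu' (IsAcyclic.upperAlgebra_le (s := u.freeze S) hu' hac)

theorem MutEquiv.le_clusterAlgebra_freeze (hs : AlgebraicIndependent ℚ s.cluster)
    (hu : s.MutEquiv u) (hac : (u.freeze S).IsAcyclic) :
    s.clusterAlgebra ≤ (u.freeze S).clusterAlgebra := by
  rw [hu.clusterAlgebra_freeze_eq hs hac]
  exact fun z hz => Algebra.subset_adjoin (Or.inl hz)

/-- The product of the variables at the vertices in `S`. -/
def chartFun (hu : s.MutEquiv u) (S : Finset (Fin n)) : s.clusterAlgebra :=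
  ∏ i ∈ S, ⟨u.cluster i, hu.cluster_mem i⟩

theorem isLocalization_chart (hs : AlgebraicIndependent ℚ s.cluster) (hu : s.MutEquiv u)
    (hac : (u.freeze S).IsAcyclic) (h : s.clusterAlgebra ≤ (u.freeze S).clusterAlgebra) :
    letI := (Subalgebra.inclusion h).toRingHom.toAlgebra
    IsLocalization.Away (chartFun hu S) (u.freeze S).clusterAlgebra := by
  have hu' := hu.algebraicIndependent hs
  have hcoe : ((chartFun hu S : s.clusterAlgebra) : RatFunField n) = ∏ i ∈ S, u.cluster i := by
    simp [chartFun]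
  refine isLocalization_away_inclusion h _ ?_ ?_ fun z hz => ?_
  · rw [hcoe]
    exact Finset.prod_ne_zero_iff.2 fun i _ => hu'.ne_zero i
  · rw [hcoe, ← Finset.prod_inv_distrib]
    exact Subalgebra.prod_mem _ fun i hi =>
      (u.freeze S).inv_cluster_mem (Finset.mem_union_right _ hi)
  · rw [hcoe]
    rw [hu.clusterAlgebra_freeze_eq hs hac] at hz
    exact exists_pow_mul_mem hu' (fun i _ => hu.cluster_mem i) hz

theorem isOpenImmersion_chartMap (hs : AlgebraicIndependent ℚ s.cluster) (hu : s.MutEquiv u)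
    (hac : (u.freeze S).IsAcyclic) (h : s.clusterAlgebra ≤ (u.freeze S).clusterAlgebra) :
    IsOpenImmersion (chartMap s (u.freeze S) h) := by
  let _ := (Subalgebra.inclusion h).toRingHom.toAlgebra
  have := isLocalization_chart hs hu hac h
  exact IsOpenImmersion.of_isLocalization (S := (u.freeze S).clusterAlgebra) (chartFun hu S)

theorem mem_range_chartMap (hs : AlgebraicIndependent ℚ s.cluster) (hu : s.MutEquiv u)
    (hac : (u.freeze S).IsAcyclic) (h : s.clusterAlgebra ≤ (u.freeze S).clusterAlgebra)
    (P : PrimeSpectrum s.clusterAlgebra) (hP : chartFun hu S ∉ P.asIdeal) :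
    (P : s.clusterScheme) ∈ Set.range (chartMap s (u.freeze S) h) := by
  let _ := (Subalgebra.inclusion h).toRingHom.toAlgebra
  have := isLocalization_chart hs hu hac h
  have h2 := PrimeSpectrum.localization_away_comap_range (u.freeze S).clusterAlgebra (chartFun hu S)
  have h3 : P ∈ Set.range (PrimeSpectrum.comap
      (algebraMap s.clusterAlgebra (u.freeze S).clusterAlgebra)) := by
    rw [h2]
    exact hP
  exact h3

end Chart

theorem BanffOutput.isFiniteAcyclicCover {O : Set (Seed n)} (h : s.BanffOutput O)
    (hs : AlgebraicIndependent ℚ s.cluster) : s.IsFiniteAcyclicCover O where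
  finite := h.finite
  acyclic t ht := ⟨t, Relation.ReflTransGen.refl, h.isAcyclic t ht⟩
  localization t ht := by
    obtain ⟨u, S, hu, hS, rfl⟩ := h.exists_eq_freeze t ht
    exact ⟨u, S, hu, hS, rfl, hu.clusterAlgebra_freeze_eq hs (h.isAcyclic _ ht)⟩
  openImmersion t ht := by
    obtain ⟨u, S, hu, hS, rfl⟩ := h.exists_eq_freeze t ht
    have hac := h.isAcyclic _ ht
    exact ⟨hu.le_clusterAlgebra_freeze hs hac, isOpenImmersion_chartMap hs hu hac _⟩
  covers P := by
    let P' : PrimeSpectrum s.clusterAlgebra := P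
    obtain ⟨_, ht, u, S, hu, hS, rfl, hne⟩ :=
      h.exists_chartContains hs (algebraMap s.clusterAlgebra P'.asIdeal.ResidueField)
    have hac := h.isAcyclic _ ht
    refine ⟨_, ht, hu.le_clusterAlgebra_freeze hs hac, mem_range_chartMap hs hu hac _ P' ?_⟩
    -- The point lies in the chart because the product of the inverted variables is nonzero in its
    -- residue field.
    rw [← Ideal.algebraMap_residueField_eq_zero, chartFun, map_prod]
    exact Finset.prod_ne_zero_iff.2 hne

end Seed

end ClusterAlg

end

theorem theorem5p5 (n : ℕ) (s : ClusterAlg.Seed n)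
    (hs : AlgebraicIndependent ℚ s.cluster)
    (O : Set (ClusterAlg.Seed n)) (hO : s.BanffOutput O) :
    (∀ t ∈ O, t.IsAcyclic) ∧ s.IsFiniteAcyclicCover O ∧ s.LocallyAcyclic :=
  ⟨hO.isAcyclic, hO.isFiniteAcyclicCover hs, O, hO.isFiniteAcyclicCover hs⟩
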